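/- **Setting.** Let $(\eta_{k,t})_{k\ge 1,\,t\in\mathbb Z}$ be i.i.d. real random variables with $E\eta_{k,t}=0$, $E\eta_{k,t}^2=1$ and $E\eta_{k,t}^4<\infty$. Let $p=p(n)\to\infty$ be integers and write $\eta_t=(\eta_{1,t},\dots,\eta_{p,t})'\in\mathbb R^{p}$. For each $n$ let $A_j=A_j^{(n)}$ $(j\ge 0)$ be deterministic real $p\times p$ matrices with $\gamma_p:=\sum_{j\ge 0}\|A_j\|_2<\infty$, where $\|\cdot\|_2$ is the spectral norm (and the Euclidean norm for vectors), and let $\mu_1=\mu_1^{(n)}$, $\mu_2=\mu_2^{(n)}\in\mathbb R^{p}$ be deterministic. Fix $c^*\in(0,1/2)$, let $T_n=\{m/n: m\in\mathbb N\}\cap(c^*,1-c^*)$, and let $\tau_n\in T_n$ for all large $n$. One observes, for $1\le t\le n$, $$X_t=\mu_1 I(t\le n\tau_n)+\mu_2 I(t>n\tau_n)+\varepsilon_t,\qquad \varepsilon_t=\sum_{j=0}^{\infty}A_j\eta_{t-j}.$$ For $b\in T_n$ let $\hat\mu_{1k}(b)=\frac1{nb}\sum_{t=1}^{nb}X_{kt}$,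 $\hat\mu_{2k}(b)=\frac1{n(1-b)}\sum_{t=nb+1}^{n}X_{kt}$ and $$L(b)=\frac1n\sum_{k=1}^{p}\Big[\sum_{t=1}^{nb}(X_{kt}-\hat\mu_{1k}(b))^2+\sum_{t=nb+1}^{n}(X_{kt}-\hat\mu_{2k}(b))^2\Big],$$ and let the least squares estimator $\hat\tau_n$ be any minimizer of $L$ over $T_n$. **Theorem.** If (SNR) $\ \frac{n\gamma_p^{-2}}{p}\|\mu_1-\mu_2\|_2^2\to\infty$ as $n\to\infty$, then $$n\,\gamma_p^{-2}\,\|\mu_1-\mu_2\|_2^2\,(\hat\tau_n-\tau_n)=O_P(1),$$ that is, for every $\epsilon>0$ there is $M<\infty$ such that $P\big(|n\gamma_p^{-2}\|\mu_1-\mu_2\|_2^2(\hat\tau_n-\tau_n)|>M\big)\le\epsilon$ for all sufficiently large $n$. -/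

import Mathlib

open MeasureTheory ProbabilityTheory Filter
open scoped ENNReal

namespace PanelChangePoint

/-- An array `η k t` (coordinate `k`, time `t ∈ ℤ`) of i.i.d. real random variables with mean `0`,
variance `1` and finite fourth moment. -/
structure IsInnovationArray {Ω : Type*} [MeasurableSpace Ω] (P : Measure Ω)
    (η : ℕ → ℤ → Ω → ℝ) : Prop where
  measurable : ∀ k t, Measurable (η k t)
  indep : iIndepFun (fun i : ℕ × ℤ => η i.1 i.2) P
  identDistrib : ∀ k t, IdentDistrib (η k t) (η 0 0) P P
  mean_zero : ∀ k t, ∫ ω, η k t ω ∂P = 0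
  variance_one : ∀ k t, variance (η k t) P = 1
  fourth_moment : ∀ k t, MemLp (η k t) 4 P

/-- The `p`-dimensional innovation at time `t`: the first `p` coordinates of the array, so that
the innovation vectors for different `p` are nested. -/
noncomputable def innovation {Ω : Type*} (η : ℕ → ℤ → Ω → ℝ) (p : ℕ) (t : ℤ) (ω : Ω) :
    EuclideanSpace ℝ (Fin p) :=
  WithLp.toLp 2 (fun k : Fin p => η k t ω)

/-- The spectral norm `‖M‖₂` of a square matrix: its operator norm on Euclidean space. -/
noncomputable def specNorm {p : ℕ} (M : Matrix (Fin p) (Fin p) ℝ) : ℝ :=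
  ‖Matrix.toEuclideanCLM (n := Fin p) (𝕜 := ℝ) M‖

/-- `γ = ∑ⱼ ‖Aⱼ‖₂`. -/
noncomputable def gammaCoef {p : ℕ} (A : ℕ → Matrix (Fin p) (Fin p) ℝ) : ℝ :=
  ∑' j : ℕ, specNorm (A j)

/-- The vector MA(∞) error `ε_t = ∑_{j ≥ 0} A_j η_{t-j}`. When `∑ⱼ ‖Aⱼ‖₂ < ∞`, the series
converges absolutely almost surely (`ae_summable_maError`). -/
noncomputable def maError {Ω : Type*} {p : ℕ} (A : ℕ → Matrix (Fin p) (Fin p) ℝ)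
    (η : ℕ → ℤ → Ω → ℝ) (t : ℤ) (ω : Ω) : EuclideanSpace ℝ (Fin p) :=
  ∑' j : ℕ, Matrix.toEuclideanCLM (n := Fin p) (𝕜 := ℝ) (A j) (innovation η p (t - j) ω)

/-- The observation `X_t = μ₁ I(t ≤ [nτ]) + μ₂ I(t > [nτ]) + ε_t`. -/
noncomputable def observation {Ω : Type*} {p : ℕ} (n : ℕ) (τ : ℝ)
    (μ₁ μ₂ : EuclideanSpace ℝ (Fin p)) (A : ℕ → Matrix (Fin p) (Fin p) ℝ)
    (η : ℕ → ℤ → Ω → ℝ) (ω : Ω) (t : ℕ) : EuclideanSpace ℝ (Fin p) :=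
  (if t ≤ ⌊(n : ℝ) * τ⌋₊ then μ₁ else μ₂) + maError A η t ω

/-- `μ̂_{1k}(b)`, the mean of the `k`-th coordinate over times `1, …, nb`. -/
noncomputable def meanBefore {p : ℕ} (n : ℕ) (x : ℕ → EuclideanSpace ℝ (Fin p)) (b : ℝ)
    (k : Fin p) : ℝ :=
  1 / ((n : ℝ) * b) * ∑ t ∈ Finset.Icc 1 ⌊(n : ℝ) * b⌋₊, x t k

/-- `μ̂_{2k}(b)`, the mean of the `k`-th coordinate over times `nb + 1, …, n`. -/
noncomputable def meanAfter {p : ℕ} (n : ℕ) (x : ℕ → EuclideanSpace ℝ (Fin p)) (b : ℝ)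
    (k : Fin p) : ℝ :=
  1 / ((n : ℝ) * (1 - b)) * ∑ t ∈ Finset.Icc (⌊(n : ℝ) * b⌋₊ + 1) n, x t k

/-- The least squares criterion `L(b)`. -/
noncomputable def lsCriterion {p : ℕ} (n : ℕ) (x : ℕ → EuclideanSpace ℝ (Fin p)) (b : ℝ) : ℝ :=
  1 / (n : ℝ) * ∑ k : Fin p,
    (∑ t ∈ Finset.Icc 1 ⌊(n : ℝ) * b⌋₊, (x t k - meanBefore n x b k) ^ 2 +
      ∑ t ∈ Finset.Icc (⌊(n : ℝ) * b⌋₊ + 1) n, (x t k - meanAfter n x b k) ^ 2)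

/-- The admissible break fractions: the multiples of `1/n` in the open interval `(c, 1 - c)`. -/
def candidates (n : ℕ) (c : ℝ) : Set ℝ :=
  {b | (∃ m : ℕ, b = (m : ℝ) / (n : ℝ)) ∧ c < b ∧ b < 1 - c}

/-- `b` is a least squares estimate: it minimizes `L` over the admissible break fractions. -/
def IsLeastSquaresEstimate {p : ℕ} (n : ℕ) (c : ℝ) (x : ℕ → EuclideanSpace ℝ (Fin p))
    (b : ℝ) : Prop :=
  b ∈ candidates n c ∧ ∀ b' ∈ candidates n c, lsCriterion n x b ≤ lsCriterion n x b'

/-- `Y_n = O_P(1)`. -/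
def IsBigOPOne {Ω : Type*} [MeasurableSpace Ω] (P : Measure Ω) (Y : ℕ → Ω → ℝ) : Prop :=
  ∀ ε : ℝ≥0∞, 0 < ε → ∃ M : ℝ, ∀ᶠ n in atTop, P {ω | M < |Y n ω|} ≤ ε

/-- The series defining the MA(∞) error converges absolutely almost surely. -/
theorem ae_summable_maError {Ω : Type*} [MeasurableSpace Ω] {P : Measure Ω}
    [IsProbabilityMeasure P] {η : ℕ → ℤ → Ω → ℝ} (hη : IsInnovationArray P η) {p : ℕ}
    {A : ℕ → Matrix (Fin p) (Fin p) ℝ} (hA : Summable fun j => specNorm (A j)) (t : ℤ) :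
    ∀ᵐ ω ∂P, Summable fun j : ℕ =>
      ‖Matrix.toEuclideanCLM (n := Fin p) (𝕜 := ℝ) (A j) (innovation η p (t - j) ω)‖ := by
  have hint : ∀ s : ℤ, Integrable (fun ω => ∑ k : Fin p, |η k s ω|) P := fun s =>
    integrable_finsetSum _ fun k _ =>
      ((hη.fourth_moment k s).integrable (by norm_num)).abs
  have hval : ∀ s : ℤ, ∫⁻ ω, ENNReal.ofReal (∑ k : Fin p, |η k s ω|) ∂P
      = ENNReal.ofReal (∑ _k : Fin p, ∫ ω, |η 0 0 ω| ∂P) := by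
    intro s
    rw [← ofReal_integral_eq_lintegral_ofReal (hint s)
      (Eventually.of_forall fun ω => Finset.sum_nonneg fun k _ => abs_nonneg _),
      integral_finsetSum (μ := P) Finset.univ (f := fun (k : Fin p) ω => |η k s ω|)
        fun k _ => ((hη.fourth_moment k s).integrable (by norm_num)).abs]
    congr 1
    refine Finset.sum_congr rfl fun k _ => ?_
    exact ((hη.identDistrib k s).comp (u := fun x : ℝ => |x|) (by fun_prop)).integral_eq
  set K : ℝ := ∑ _k : Fin p, ∫ ω, |η 0 0 ω| ∂P with hK
  have hmeas : ∀ s : ℤ, Measurable fun ω => ∑ k : Fin p, |η k s ω| := fun s =>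
    Finset.measurable_sum _ fun k _ => (hη.measurable k s).abs
  have hfin : ∫⁻ ω, ∑' j : ℕ, ENNReal.ofReal (specNorm (A j)) *
      ENNReal.ofReal (∑ k : Fin p, |η k (t - j) ω|) ∂P ≠ ∞ := by
    rw [lintegral_tsum fun j : ℕ => ((hmeas (t - j)).ennreal_ofReal.const_mul _).aemeasurable]
    simp_rw [lintegral_const_mul _ (hmeas _).ennreal_ofReal, hval]
    rw [ENNReal.tsum_mul_right]
    exact ENNReal.mul_ne_top hA.tsum_ofReal_ne_top ENNReal.ofReal_ne_top
  have hae := ae_lt_top'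
    (AEMeasurable.tsum fun j : ℕ => ((hmeas (t - j)).ennreal_ofReal.const_mul _).aemeasurable) hfin
  filter_upwards [hae] with ω hω
  have hs : Summable fun j : ℕ => specNorm (A j) * ∑ k : Fin p, |η k (t - j) ω| := by
    have h := ENNReal.summable_toReal hω.ne
    refine h.congr fun j => ?_
    rw [ENNReal.toReal_mul, ENNReal.toReal_ofReal (show 0 ≤ specNorm (A j) from norm_nonneg _),
      ENNReal.toReal_ofReal (Finset.sum_nonneg fun k _ => abs_nonneg _)]
  refine hs.of_nonneg_of_le (fun _ => norm_nonneg _) fun j => ?_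
  refine (ContinuousLinearMap.le_opNorm _ _).trans ?_
  refine mul_le_mul_of_nonneg_left ?_ (norm_nonneg _)
  rw [EuclideanSpace.norm_eq]
  refine Real.sqrt_le_iff.2 ⟨Finset.sum_nonneg fun k _ => abs_nonneg _, ?_⟩
  exact Finset.sum_sq_le_sq_sum_of_nonneg fun k _ => norm_nonneg _

end PanelChangePoint

open PanelChangePoint

/-! Write `δ` for the norm of the jump `v = μ₁ - μ₂` and `γ` for the sum of the operator norms.
Minimizing the criterion is maximizing the between-segment sum of squares `splitScore`. Moving the
split `d` steps off the true change point costs a drift of order `d δ²`. Against it stand noise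
terms: the inner product of `v` with the noise sum `W` over the `d` steps, `‖W‖²`, the inner
products of `W` with the noise sums `S`, `S'` over the two regimes, and `‖S‖`, `‖S'‖`. If all are
small multiples of their natural scale (`NoiseSmall`), the wrong split scores strictly less
(`splitScore_lt_of_noiseSmall`) and is not a minimizer. So it suffices that, with high probability,
this holds simultaneously for all `d > M γ²/δ²`.

The distances are covered by dyadic blocks `y ≤ d ≤ 2y` with `y = M (γ²/δ²) 2^i`, and a maximal
inequality handles each block (`measure_blockViolation_le`). The inner products with `v` have second
moment of order `γ² y δ²` against the threshold `y δ²`, so they fail with probability of order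
`γ²/(y δ²)`, which sums geometrically to `O(1/M)`. The majorant of `‖W‖²` has mean of order `γ² y
p`, negligible against `y n δ²` by (SNR). Since coordinates are independent, its fluctuation has
second moment of order `γ⁴ p y²` and not `γ⁴ p² y²`; a block then fails with probability of order
`γ⁴ p/(n² δ⁴)`, and even `n δ²/γ²` blocks together contribute only `γ² p/(n δ²)`, which tends to
`0`.

The delicate terms are the inner products of `S` or `S'` with `W`, which share innovations. Both
sums are expanded over lags. For each pair of lags, the shared innovations give a term bounded by
the majorant of `‖W‖²`; the others are independent of the innovations in `W` and give a martingale
transform (`exists_majorant_inner_sum`). A weighted Cauchy–Schwarz inequality over lags makes all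
bounds depend on the operators only through `γ`. -/

/-! ### Maximal inequalities for partial sums -/

/-- The running maximum of `0` and the partial sums of a sequence. -/
noncomputable def runningMax (x : ℕ → ℝ) : ℕ → ℝ
  | 0 => 0
  | n + 1 => max (runningMax x n) (∑ i ∈ Finset.range (n + 1), x i)

theorem runningMax_nonneg (x : ℕ → ℝ) (n : ℕ) : 0 ≤ runningMax x n := by
  induction n with
  | zero => exact le_rfl
  | succ n ih => exact le_max_of_le_left ih

theorem runningMax_mono (x : ℕ → ℝ) : Monotone (runningMax x) :=
  monotone_nat_of_le_succ fun _ => le_max_left _ _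

theorem sum_range_le_runningMax (x : ℕ → ℝ) {d n : ℕ} (h : d ≤ n) :
    ∑ i ∈ Finset.range d, x i ≤ runningMax x n := by
  refine le_trans ?_ (runningMax_mono x h)
  cases d with
  | zero => simp [runningMax]
  | succ d => exact le_max_right _ _

/-- Summation by parts: the running maximum increases only at steps where it equals the partial sum,
which yields the square term. -/
theorem sum_runningMax_mul_le (x : ℕ → ℝ) (n : ℕ) :
    ∑ k ∈ Finset.range n, runningMax x k * x k ≤
      runningMax x n * ∑ i ∈ Finset.range n, x i - runningMax x n ^ 2 / 2 := by
  induction n with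
  | zero => simp [runningMax]
  | succ n ih =>
    rw [Finset.sum_range_succ]
    have hS := Finset.sum_range_succ x n
    set S' := ∑ i ∈ Finset.range (n + 1), x i with hS'
    set S := ∑ i ∈ Finset.range n, x i
    have hM : runningMax x (n + 1) = max (runningMax x n) S' := rfl
    rw [hM]
    rcases max_cases (runningMax x n) S' with ⟨h, -⟩ | ⟨h, -⟩ <;> rw [h]
    · rw [hS]; linarith
    · have : x n = S' - S := by linarith
      rw [this]
      nlinarith [sq_nonneg (S' - runningMax x n)]

theorem sum_runningMax_cube_mul_le (x : ℕ → ℝ) (n : ℕ) :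
    ∑ k ∈ Finset.range n, runningMax x k ^ 3 * x k ≤
      runningMax x n ^ 3 * ∑ i ∈ Finset.range n, x i - 3 / 4 * runningMax x n ^ 4 := by
  induction n with
  | zero => simp [runningMax]
  | succ n ih =>
    rw [Finset.sum_range_succ]
    have hS := Finset.sum_range_succ x n
    set S' := ∑ i ∈ Finset.range (n + 1), x i with hS'
    set S := ∑ i ∈ Finset.range n, x i
    set M := runningMax x n
    have hM : runningMax x (n + 1) = max M S' := rfl
    rw [hM]
    rcases max_cases M S' with ⟨h, -⟩ | ⟨h, -⟩ <;> rw [h]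
    · rw [hS]; linarith
    · have : x n = S' - S := by linarith
      rw [this]
      -- This product equals `S' ^ 4 - 4 * M ^ 3 * S' + 3 * M ^ 4`, the convexity gap of the fourth
      -- power at `M`.
      have : 0 ≤ (S' - M) ^ 2 * ((S' + M) ^ 2 + 2 * M ^ 2) := by positivity
      nlinarith

/-- A pathwise form of Doob's `L²` inequality. The weight `runningMax x k` involves only `x 0, …, x
(k - 1)`, so for martingale differences the last sum has mean zero. -/
theorem runningMax_sq_le (x : ℕ → ℝ) (n : ℕ) :
    runningMax x n ^ 2 ≤ 4 * (∑ i ∈ Finset.range n, x i) ^ 2 -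
      4 * ∑ k ∈ Finset.range n, runningMax x k * x k := by
  nlinarith [sum_runningMax_mul_le x n,
    sq_nonneg (2 * ∑ i ∈ Finset.range n, x i - runningMax x n)]

theorem runningMax_fourth_le (x : ℕ → ℝ) (n : ℕ) :
    runningMax x n ^ 4 ≤ 16 / 3 * (∑ i ∈ Finset.range n, x i) ^ 4 -
      8 / 3 * ∑ k ∈ Finset.range n, runningMax x k ^ 3 * x k := by
  have h := sum_runningMax_cube_mul_le x n
  set M := runningMax x n
  set S := ∑ i ∈ Finset.range n, x i
  have h1 : M ^ 3 * S ≤ M ^ 2 * (M ^ 2 / 4 + S ^ 2) := by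
    have : 0 ≤ M ^ 2 * (M / 2 - S) ^ 2 := by positivity
    nlinarith
  have h2 : M ^ 2 * S ^ 2 ≤ M ^ 4 / 8 + 2 * S ^ 4 := by
    nlinarith [sq_nonneg (M ^ 2 / 4 - S ^ 2)]
  nlinarith

/-- A majorant of the squares of the first `n` partial sums of a sequence. -/
noncomputable def maxSq (x : ℕ → ℝ) (n : ℕ) : ℝ :=
  runningMax x n ^ 2 + runningMax (fun i => -x i) n ^ 2

theorem maxSq_nonneg (x : ℕ → ℝ) (n : ℕ) : 0 ≤ maxSq x n := by
  unfold maxSq; positivity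

theorem sq_sum_range_le_maxSq (x : ℕ → ℝ) {d n : ℕ} (h : d ≤ n) :
    (∑ i ∈ Finset.range d, x i) ^ 2 ≤ maxSq x n := by
  have h1 := sum_range_le_runningMax x h
  have h2 := sum_range_le_runningMax (fun i => -x i) h
  rw [Finset.sum_neg_distrib] at h2
  have h3 := runningMax_nonneg x n
  have h4 := runningMax_nonneg (fun i => -x i) n
  unfold maxSq
  rcases le_total 0 (∑ i ∈ Finset.range d, x i) with h0 | h0 <;> nlinarith

/-! ### Martingale differences and the second-moment maximal inequality -/

/-- `D 0, …, D (n - 1)` are square integrable martingale differences for `F`. -/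
structure IsMartingaleDiff {Ω : Type*} [mΩ : MeasurableSpace Ω] (P : Measure Ω)
    (F : ℕ → MeasurableSpace Ω) (D : ℕ → Ω → ℝ) (n : ℕ) : Prop where
  mono : Monotone F
  le : ∀ k, F k ≤ mΩ
  meas : ∀ k < n, Measurable[F (k + 1)] (D k)
  memLp : ∀ k < n, MemLp (D k) 2 P
  -- Orthogonality to square integrable predictable variables stands in for a vanishing conditional
  -- expectation; no other consequence is needed.
  orth : ∀ k < n, ∀ Y : Ω → ℝ, Measurable[F k] Y → MemLp Y 2 P → ∫ ω, Y ω * D k ω ∂P = 0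

namespace IsMartingaleDiff

variable {Ω : Type*} [mΩ : MeasurableSpace Ω] {P : Measure Ω} {F : ℕ → MeasurableSpace Ω}
  {D : ℕ → Ω → ℝ} {n : ℕ}

theorem neg (h : IsMartingaleDiff P F D n) : IsMartingaleDiff P F (fun k ω => -D k ω) n where
  mono := h.mono
  le := h.le
  meas k hk := (h.meas k hk).neg
  memLp k hk := (h.memLp k hk).neg
  orth k hk Y hY hY' := by
    simp only [mul_neg, integral_neg, h.orth k hk Y hY hY', neg_zero]

theorem measurable_sum (h : IsMartingaleDiff P F D n) {k : ℕ} (hk : k ≤ n) :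
    Measurable[F k] fun ω => ∑ i ∈ Finset.range k, D i ω := by
  induction k with
  | zero => simp
  | succ k ih =>
    simp only [Finset.sum_range_succ]
    exact ((ih (by omega)).mono (h.mono (Nat.le_succ k)) le_rfl).add (h.meas k hk)

theorem measurable_runningMax (h : IsMartingaleDiff P F D n) {k : ℕ} (hk : k ≤ n) :
    Measurable[F k] fun ω => runningMax (fun i => D i ω) k := by
  induction k with
  | zero => exact measurable_const
  | succ k ih =>
    exact ((ih (by omega)).mono (h.mono (Nat.le_succ k)) le_rfl).max (h.measurable_sum hk)

theorem memLp_sum (_ : IsMartingaleDiff P F D n) {q : ℝ≥0∞} (hq : ∀ k < n, MemLp (D k) q P)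
    {k : ℕ} (hk : k ≤ n) : MemLp (fun ω => ∑ i ∈ Finset.range k, D i ω) q P :=
  memLp_finsetSum _ fun i hi => hq i ((Finset.mem_range.1 hi).trans_le hk)

theorem memLp_runningMax (h : IsMartingaleDiff P F D n) {q : ℝ≥0∞}
    (hq : ∀ k < n, MemLp (D k) q P) {k : ℕ} (hk : k ≤ n) :
    MemLp (fun ω => runningMax (fun i => D i ω) k) q P := by
  induction k with
  | zero => exact MemLp.zero
  | succ k ih => exact (ih (by omega)).sup (h.memLp_sum hq hk)

theorem integral_sum_sq (h : IsMartingaleDiff P F D n) {k : ℕ} (hk : k ≤ n) :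
    ∫ ω, (∑ i ∈ Finset.range k, D i ω) ^ 2 ∂P =
      ∑ i ∈ Finset.range k, ∫ ω, D i ω ^ 2 ∂P := by
  induction k with
  | zero => simp
  | succ k ih =>
    have hS := h.memLp_sum h.memLp (k := k) (by omega)
    have hD := h.memLp k hk
    have e : ∀ ω, (∑ i ∈ Finset.range (k + 1), D i ω) ^ 2 =
        (∑ i ∈ Finset.range k, D i ω) ^ 2 + (2 * ((∑ i ∈ Finset.range k, D i ω) * D k ω) +
          D k ω ^ 2) := fun ω => by rw [Finset.sum_range_succ]; ring
    have i1 := hS.integrable_sq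
    have i2 : Integrable (fun ω => (∑ i ∈ Finset.range k, D i ω) * D k ω) P :=
      hS.integrable_mul hD
    have i3 := hD.integrable_sq
    have i4 : Integrable (fun ω => 2 * ((∑ i ∈ Finset.range k, D i ω) * D k ω) + D k ω ^ 2) P :=
      (i2.const_mul 2).add i3
    simp_rw [e]
    rw [integral_add i1 i4, integral_add (i2.const_mul 2) i3,
      integral_const_mul, h.orth k hk _ (h.measurable_sum (by omega)) hS, ih (by omega),
      Finset.sum_range_succ]
    ring

theorem integral_runningMax_sq_le (h : IsMartingaleDiff P F D n) :
    ∫ ω, runningMax (fun i => D i ω) n ^ 2 ∂P ≤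
      4 * ∑ i ∈ Finset.range n, ∫ ω, D i ω ^ 2 ∂P := by
  rw [← h.integral_sum_sq le_rfl]
  have hS := (h.memLp_sum h.memLp le_rfl).integrable_sq
  have hk : ∀ k ∈ Finset.range n,
      Integrable (fun ω => runningMax (fun i => D i ω) k * D k ω) P := fun k hk =>
    (h.memLp_runningMax h.memLp (Finset.mem_range.1 hk).le).integrable_mul
      (h.memLp k (Finset.mem_range.1 hk))
  calc _ ≤ ∫ ω, (4 * (∑ i ∈ Finset.range n, D i ω) ^ 2 -
        4 * ∑ k ∈ Finset.range n, runningMax (fun i => D i ω) k * D k ω) ∂P :=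
        integral_mono (h.memLp_runningMax h.memLp le_rfl).integrable_sq
          ((hS.const_mul 4).sub ((integrable_finsetSum _ hk).const_mul 4))
          fun ω => runningMax_sq_le _ n
    _ = _ := by
        rw [integral_sub (hS.const_mul 4) ((integrable_finsetSum _ hk).const_mul 4),
          integral_const_mul, integral_const_mul, integral_finsetSum _ hk,
          Finset.sum_eq_zero, mul_zero, sub_zero]
        intro k hk
        have hk := Finset.mem_range.1 hk
        exact h.orth k hk _ (h.measurable_runningMax hk.le) (h.memLp_runningMax h.memLp hk.le)

theorem integrable_maxSq (h : IsMartingaleDiff P F D n) :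
    Integrable (fun ω => maxSq (fun i => D i ω) n) P :=
  (h.memLp_runningMax h.memLp le_rfl).integrable_sq.add
    (h.neg.memLp_runningMax h.neg.memLp le_rfl).integrable_sq

theorem integral_maxSq_le (h : IsMartingaleDiff P F D n) :
    ∫ ω, maxSq (fun i => D i ω) n ∂P ≤ 8 * ∑ i ∈ Finset.range n, ∫ ω, D i ω ^ 2 ∂P := by
  unfold maxSq
  rw [integral_add (h.memLp_runningMax h.memLp le_rfl).integrable_sq
    (h.neg.memLp_runningMax h.neg.memLp le_rfl).integrable_sq]
  have h1 := h.integral_runningMax_sq_le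
  have h2 := h.neg.integral_runningMax_sq_le
  simp only [neg_sq] at h2
  linarith

end IsMartingaleDiff

/-! ### Independent differences and the fourth-moment maximal inequality -/

/-- Independent centred variables with unit variance and bounded fourth moment. -/
structure IsIndepDiff {Ω : Type*} [mΩ : MeasurableSpace Ω] (P : Measure Ω)
    (F : ℕ → MeasurableSpace Ω) (D : ℕ → Ω → ℝ) (n : ℕ) (K : ℝ) : Prop where
  mono : Monotone F
  le : ∀ k, F k ≤ mΩ
  meas : ∀ k < n, Measurable[F (k + 1)] (D k)
  memLp : ∀ k < n, MemLp (D k) 4 P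
  indep : ∀ k < n, Indep (F k) (MeasurableSpace.comap (D k) inferInstance) P
  mean : ∀ k < n, ∫ ω, D k ω ∂P = 0
  second : ∀ k < n, ∫ ω, D k ω ^ 2 ∂P = 1
  fourth : ∀ k < n, ∫ ω, D k ω ^ 4 ∂P ≤ K

namespace IsIndepDiff

variable {Ω : Type*} [mΩ : MeasurableSpace Ω] {P : Measure Ω}
  {F : ℕ → MeasurableSpace Ω} {D : ℕ → Ω → ℝ} {n : ℕ} {K : ℝ}

theorem neg (h : IsIndepDiff P F D n K) : IsIndepDiff P F (fun k ω => -D k ω) n K where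
  mono := h.mono
  le := h.le
  meas k hk := (h.meas k hk).neg
  memLp k hk := (h.memLp k hk).neg
  indep k hk := indep_of_indep_of_le_right (h.indep k hk)
    ((measurable_neg.comp (comap_measurable (D k))).comap_le)
  mean k hk := by rw [integral_neg, h.mean k hk, neg_zero]
  second k hk := by simpa using h.second k hk
  fourth k hk := by simpa [Even.neg_pow (by decide : Even 4)] using h.fourth k hk

theorem indepFun (h : IsIndepDiff P F D n K) {k : ℕ} (hk : k < n) {Y : Ω → ℝ}
    (hY : Measurable[F k] Y) {f : ℝ → ℝ} (hf : Measurable f) :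
    IndepFun Y (fun ω => f (D k ω)) P := by
  rw [IndepFun_iff_Indep]
  exact indep_of_indep_of_le_right (indep_of_indep_of_le_left (h.indep k hk) hY.comap_le)
    ((hf.comp (comap_measurable (D k))).comap_le)

theorem measurable_D (h : IsIndepDiff P F D n K) {k : ℕ} (hk : k < n) : Measurable (D k) :=
  (h.meas k hk).mono (h.le _) le_rfl

theorem integral_mul (h : IsIndepDiff P F D n K) {k : ℕ} (hk : k < n) {Y : Ω → ℝ}
    (hY : Measurable[F k] Y) {f : ℝ → ℝ} (hf : Measurable f) :
    ∫ ω, Y ω * f (D k ω) ∂P = (∫ ω, Y ω ∂P) * ∫ ω, f (D k ω) ∂P :=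
  (h.indepFun hk hY hf).integral_mul_eq_mul_integral
    (hY.mono (h.le _) le_rfl).aestronglyMeasurable
    (hf.comp (h.measurable_D hk)).aestronglyMeasurable

theorem integrable_pow_four {X : Ω → ℝ} (hX : MemLp X 4 P) : Integrable (fun ω => X ω ^ 4) P := by
  have h := MemLp.integrable_norm_pow (p := 4) (by exact_mod_cast hX) (by norm_num)
  refine h.congr (Eventually.of_forall fun ω => ?_)
  simp [Even.pow_abs (by decide : Even 4)]

variable [IsProbabilityMeasure P]

theorem isMartingaleDiff (h : IsIndepDiff P F D n K) : IsMartingaleDiff P F D n where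
  mono := h.mono
  le := h.le
  meas := h.meas
  memLp k hk := (h.memLp k hk).mono_exponent (by norm_num)
  orth k hk Y hY _ := by
    have := h.integral_mul hk hY measurable_id
    simpa [h.mean k hk] using this

theorem integrable_mul_pow {X : Ω → ℝ} (h : IsIndepDiff P F D n K) {k : ℕ} (hk : k < n)
    (hX : Measurable[F k] X) (hX' : MemLp X 4 P) (i j : ℕ) (hi : i ≤ 4) (hj : j ≤ 4) :
    Integrable (fun ω => X ω ^ i * D k ω ^ j) P := by
  have aux : ∀ (Z : Ω → ℝ), MemLp Z 4 P → ∀ i : ℕ, i ≤ 4 → Integrable (fun ω => Z ω ^ i) P := by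
    intro Z hZ i hi
    rcases Nat.eq_zero_or_pos i with rfl | h0
    · simp
    have := MemLp.integrable_norm_pow (p := i) (hZ.mono_exponent (by exact_mod_cast hi)) h0.ne'
    exact (integrable_norm_iff (hZ.aestronglyMeasurable.pow i)).1
      (this.congr (Eventually.of_forall fun ω => by simp))
  have hi' : Measurable[F k] fun ω => X ω ^ i := hX.pow_const i
  exact (h.indepFun hk hi' (f := fun x => x ^ j) (by fun_prop)).integrable_mul
    (aux X hX' i hi) (aux _ (h.memLp k hk) j hj)

theorem integral_sum_fourth_le (h : IsIndepDiff P F D n K) {k : ℕ} (hk : k ≤ n) :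
    ∫ ω, (∑ i ∈ Finset.range k, D i ω) ^ 4 ∂P ≤ (4 + 3 * K) * k ^ 2 := by
  -- The linear term in `k` is carried separately so that the induction closes: one step adds at
  -- most `8 * k + 3 * K`.
  have key : ∀ k ≤ n, ∫ ω, (∑ i ∈ Finset.range k, D i ω) ^ 4 ∂P ≤ 4 * k ^ 2 + 3 * K * k := by
    intro k hk
    induction k with
    | zero => simp
    | succ k ih =>
      have hm := h.isMartingaleDiff
      have hS := hm.memLp_sum h.memLp (k := k) (by omega)
      have hSm := hm.measurable_sum (k := k) (by omega)
      have hD := h.memLp k hk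
      set S : Ω → ℝ := fun ω => ∑ i ∈ Finset.range k, D i ω with hSdef
      have i1 := integrable_pow_four hS
      have i2 := h.integrable_mul_pow hk hSm hS 3 1 (by norm_num) (by norm_num)
      have i3 := h.integrable_mul_pow hk hSm hS 2 2 (by norm_num) (by norm_num)
      have i4 := integrable_pow_four hD
      have e2 : ∫ ω, S ω ^ 3 * D k ω ^ 1 ∂P = 0 := by
        rw [h.integral_mul hk (hSm.pow_const 3) (f := fun x => x ^ 1) (by fun_prop)]
        simp [h.mean k hk]
      have e3 : ∫ ω, S ω ^ 2 * D k ω ^ 2 ∂P = k := by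
        rw [h.integral_mul hk (hSm.pow_const 2) (f := fun x => x ^ 2) (by fun_prop),
          h.second k hk, mul_one, hSdef, hm.integral_sum_sq (by omega),
          Finset.sum_congr rfl fun i hi => h.second i ((Finset.mem_range.1 hi).trans (by omega))]
        simp
      have i5 : Integrable (fun ω => 8 * (S ω ^ 2 * D k ω ^ 2) + 3 * D k ω ^ 4) P :=
        (i3.const_mul 8).add (i4.const_mul 3)
      have i6 : Integrable (fun ω => 4 * (S ω ^ 3 * D k ω ^ 1) + (8 * (S ω ^ 2 * D k ω ^ 2) +
          3 * D k ω ^ 4)) P := (i2.const_mul 4).add i5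
      calc _ ≤ ∫ ω, (S ω ^ 4 + (4 * (S ω ^ 3 * D k ω ^ 1) + (8 * (S ω ^ 2 * D k ω ^ 2) +
            3 * D k ω ^ 4))) ∂P := by
            refine integral_mono (integrable_pow_four (hm.memLp_sum h.memLp hk))
              (i1.add i6) fun ω => ?_
            simp only [Finset.sum_range_succ]
            change (S ω + D k ω) ^ 4 ≤ _
            -- The odd term `4 S D³` of the binomial expansion is absorbed by `2 S² D² + 2 D⁴`.
            nlinarith [sq_nonneg (S ω * D k ω - D k ω ^ 2)]
        _ = ∫ ω, S ω ^ 4 ∂P + (4 * 0 + (8 * k + 3 * ∫ ω, D k ω ^ 4 ∂P)) := by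
            rw [integral_add i1 i6, integral_add (i2.const_mul 4) i5,
              integral_add (i3.const_mul 8) (i4.const_mul 3), integral_const_mul,
              integral_const_mul, integral_const_mul, e2, e3]
        _ ≤ _ := by
            have := ih (by omega)
            have := h.fourth k hk
            push_cast
            nlinarith
  rcases Nat.eq_zero_or_pos k with rfl | h0
  · simp
  have hK : 0 ≤ K := (integral_nonneg fun ω => by positivity).trans (h.fourth 0 (by omega))
  have h1 : (1 : ℝ) ≤ k := by exact_mod_cast h0
  have := key k hk
  have : K * k ≤ K * k ^ 2 := mul_le_mul_of_nonneg_left (by nlinarith) hK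
  nlinarith

theorem integral_runningMax_fourth_le (h : IsIndepDiff P F D n K) :
    ∫ ω, runningMax (fun i => D i ω) n ^ 4 ∂P ≤ 16 / 3 * ((4 + 3 * K) * n ^ 2) := by
  have hm := h.isMartingaleDiff
  have hS := integrable_pow_four (hm.memLp_sum h.memLp le_rfl)
  have hk : ∀ k ∈ Finset.range n,
      Integrable (fun ω => runningMax (fun i => D i ω) k ^ 3 * D k ω) P := fun k hk => by
    have hk := Finset.mem_range.1 hk
    have := h.integrable_mul_pow hk (hm.measurable_runningMax hk.le)
      (hm.memLp_runningMax h.memLp hk.le) 3 1 (by norm_num) (by norm_num)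
    simpa using this
  calc _ ≤ ∫ ω, (16 / 3 * (∑ i ∈ Finset.range n, D i ω) ^ 4 -
        8 / 3 * ∑ k ∈ Finset.range n, runningMax (fun i => D i ω) k ^ 3 * D k ω) ∂P :=
        integral_mono (integrable_pow_four (hm.memLp_runningMax h.memLp le_rfl))
          ((hS.const_mul _).sub ((integrable_finsetSum _ hk).const_mul _))
          fun ω => runningMax_fourth_le _ n
    _ = 16 / 3 * ∫ ω, (∑ i ∈ Finset.range n, D i ω) ^ 4 ∂P := by
        rw [integral_sub (hS.const_mul _) ((integrable_finsetSum _ hk).const_mul _),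
          integral_const_mul, integral_const_mul, integral_finsetSum _ hk,
          Finset.sum_eq_zero, mul_zero, sub_zero]
        intro k hk
        have hk := Finset.mem_range.1 hk
        have := h.integral_mul hk ((hm.measurable_runningMax hk.le).pow_const 3) measurable_id
        simpa [h.mean k hk] using this
    _ ≤ _ := by gcongr; exact h.integral_sum_fourth_le le_rfl

theorem integral_maxSq_le (h : IsIndepDiff P F D n K) :
    ∫ ω, maxSq (fun i => D i ω) n ∂P ≤ 8 * n := by
  refine h.isMartingaleDiff.integral_maxSq_le.trans_eq ?_
  rw [Finset.sum_congr rfl fun i hi => h.second i (Finset.mem_range.1 hi)]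
  simp

theorem memLp_maxSq (h : IsIndepDiff P F D n K) :
    MemLp (fun ω => maxSq (fun i => D i ω) n) 2 P := by
  have aux : ∀ {X : Ω → ℝ}, MemLp X 4 P → MemLp (fun ω => X ω ^ 2) 2 P := fun {X} hX => by
    refine (memLp_two_iff_integrable_sq (hX.aestronglyMeasurable.pow 2)).2 ?_
    exact (integrable_pow_four hX).congr (Eventually.of_forall fun ω => by simp only [Pi.pow_apply]; ring)
  exact (aux (h.isMartingaleDiff.memLp_runningMax h.memLp le_rfl)).add
    (aux (h.neg.isMartingaleDiff.memLp_runningMax h.neg.memLp le_rfl))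

theorem integral_maxSq_sq_le (h : IsIndepDiff P F D n K) :
    ∫ ω, maxSq (fun i => D i ω) n ^ 2 ∂P ≤ (88 + 66 * K) * n ^ 2 := by
  have i1 := integrable_pow_four (h.isMartingaleDiff.memLp_runningMax h.memLp le_rfl)
  have i2 := integrable_pow_four (h.neg.isMartingaleDiff.memLp_runningMax h.neg.memLp le_rfl)
  calc _ ≤ ∫ ω, (2 * runningMax (fun i => D i ω) n ^ 4 +
        2 * runningMax (fun i => -D i ω) n ^ 4) ∂P := by
        refine integral_mono h.memLp_maxSq.integrable_sq ((i1.const_mul 2).add (i2.const_mul 2))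
          fun ω => ?_
        simp only [maxSq]
        nlinarith [sq_nonneg (runningMax (fun i => D i ω) n ^ 2 -
          runningMax (fun i => -D i ω) n ^ 2)]
    _ ≤ _ := by
        rw [integral_add (i1.const_mul 2) (i2.const_mul 2), integral_const_mul,
          integral_const_mul]
        have h1 := h.integral_runningMax_fourth_le
        have h2 := h.neg.integral_runningMax_fourth_le
        have h3 : 0 ≤ ∫ ω, runningMax (fun i => D i ω) n ^ 4 ∂P :=
          integral_nonneg fun ω => by positivity
        -- `88 + 66 * K` is `22 * (4 + 3 * K)`, while the two maxima contribute `64 / 3 * (4 + 3 *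
        -- K)`.
        nlinarith

end IsIndepDiff

/-! ### Innovations -/

section Innovations

variable {Ω : Type*} {η : ℕ → ℤ → Ω → ℝ}

/-- The σ-algebra generated by the innovations with indices in `S`. -/
@[reducible] def innovationSigma (η : ℕ → ℤ → Ω → ℝ) (S : Set (ℕ × ℤ)) : MeasurableSpace Ω :=
  ⨆ i ∈ S, MeasurableSpace.comap (η i.1 i.2) inferInstance

theorem innovationSigma_mono {S T : Set (ℕ × ℤ)} (h : S ⊆ T) :
    innovationSigma η S ≤ innovationSigma η T :=
  biSup_mono fun _ hi => h hi

theorem measurable_innovationSigma {S : Set (ℕ × ℤ)} {c : ℕ} {t : ℤ} (h : (c, t) ∈ S) :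
    Measurable[innovationSigma η S] (η c t) :=
  (comap_measurable (η c t)).mono
    (le_iSup₂_of_le (f := fun (i : ℕ × ℤ) (_ : i ∈ S) =>
      MeasurableSpace.comap (η i.1 i.2) inferInstance) (c, t) h le_rfl) le_rfl

/-- A majorant of the squared norms of the first `a` partial sums of the innovation vectors
along the times `φ`. -/
noncomputable def innovationMaxSq (η : ℕ → ℤ → Ω → ℝ) (p : ℕ) (φ : ℕ → ℤ) (a : ℕ) (ω : Ω) : ℝ :=
  ∑ c : Fin p, maxSq (fun s => η c (φ s) ω) a

theorem sum_innovation_apply {ι : Type*} (p : ℕ) (φ : ι → ℤ) (s : Finset ι) (ω : Ω) (c : Fin p) :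
    (∑ i ∈ s, innovation η p (φ i) ω) c = ∑ i ∈ s, η c (φ i) ω := by
  simp [innovation]

theorem norm_sq_sum_innovation_le (p : ℕ) (φ : ℕ → ℤ) {d a : ℕ} (h : d ≤ a) (ω : Ω) :
    ‖∑ s ∈ Finset.range d, innovation η p (φ s) ω‖ ^ 2 ≤ innovationMaxSq η p φ a ω := by
  rw [EuclideanSpace.real_norm_sq_eq]
  refine Finset.sum_le_sum fun c _ => ?_
  rw [sum_innovation_apply]
  exact sq_sum_range_le_maxSq (fun s => η c (φ s) ω) h

theorem norm_sq_sub_sum_innovation_le (p : ℕ) (φ : ℕ → ℤ) {d d' a : ℕ} (h : d ≤ a)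
    (h' : d' ≤ a) (ω : Ω) :
    ‖∑ s ∈ Finset.range d, innovation η p (φ s) ω -
      ∑ s ∈ Finset.range d', innovation η p (φ s) ω‖ ^ 2 ≤ 4 * innovationMaxSq η p φ a ω := by
  rw [EuclideanSpace.real_norm_sq_eq, innovationMaxSq, Finset.mul_sum]
  refine Finset.sum_le_sum fun c _ => ?_
  rw [PiLp.sub_apply, sum_innovation_apply, sum_innovation_apply]
  have h1 := sq_sum_range_le_maxSq (fun s => η c (φ s) ω) h
  have h2 := sq_sum_range_le_maxSq (fun s => η c (φ s) ω) h'
  nlinarith [sq_nonneg (∑ s ∈ Finset.range d, η c (φ s) ω + ∑ s ∈ Finset.range d', η c (φ s) ω)]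

theorem measurable_innovation_sigma (η : ℕ → ℤ → Ω → ℝ) {S : Set (ℕ × ℤ)} (p : ℕ) {t : ℤ}
    (h : ∀ c, (c, t) ∈ S) : Measurable[innovationSigma η S] (innovation η p t) :=
  (PiLp.continuous_toLp 2 _).measurable.comp
    (@measurable_pi_lambda _ _ _ (innovationSigma η S) _ _ fun c => measurable_innovationSigma (h c))

variable [mΩ : MeasurableSpace Ω] {P : Measure Ω}

theorem innovationSigma_le (hη : IsInnovationArray P η) (S : Set (ℕ × ℤ)) :
    innovationSigma η S ≤ mΩ :=
  iSup₂_le fun i _ => (hη.measurable i.1 i.2).comap_le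

theorem indep_innovationSigma (hη : IsInnovationArray P η) {S T : Set (ℕ × ℤ)}
    (h : Disjoint S T) : Indep (innovationSigma η S) (innovationSigma η T) P :=
  indep_iSup_of_disjoint (m := fun i : ℕ × ℤ => MeasurableSpace.comap (η i.1 i.2) inferInstance)
    (fun i => (hη.measurable i.1 i.2).comap_le)
    ((iIndepFun_iff_iIndep (fun _ => inferInstance) (fun i : ℕ × ℤ => η i.1 i.2) P).1 hη.indep) h

theorem indepFun_innovationSigma (hη : IsInnovationArray P η) {S T : Set (ℕ × ℤ)}
    (h : Disjoint S T) {f g : Ω → ℝ} (hf : Measurable[innovationSigma η S] f)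
    (hg : Measurable[innovationSigma η T] g) : IndepFun f g P := by
  rw [IndepFun_iff_Indep]
  exact indep_of_indep_of_le_right (indep_of_indep_of_le_left (indep_innovationSigma hη h)
    hf.comap_le) hg.comap_le

theorem memLp_two_innovation [IsProbabilityMeasure P] (hη : IsInnovationArray P η) (c : ℕ)
    (t : ℤ) : MemLp (η c t) 2 P :=
  (hη.fourth_moment c t).mono_exponent (by norm_num)

theorem integral_innovation_sq [IsProbabilityMeasure P] (hη : IsInnovationArray P η) (c : ℕ)
    (t : ℤ) : ∫ ω, η c t ω ^ 2 ∂P = 1 := by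
  rw [← variance_of_integral_eq_zero (hη.measurable c t).aemeasurable (hη.mean_zero c t),
    hη.variance_one]

theorem integral_innovation_mul [IsProbabilityMeasure P] (hη : IsInnovationArray P η)
    (c c' : ℕ) (t : ℤ) :
    ∫ ω, η c t ω * η c' t ω ∂P = if c = c' then 1 else 0 := by
  split_ifs with h
  · subst h
    simpa [sq] using integral_innovation_sq hη c t
  · have : IndepFun (η c t) (η c' t) P :=
      indepFun_innovationSigma hη (S := {(c, t)}) (T := {(c', t)}) (by simp [h])
        (measurable_innovationSigma rfl) (measurable_innovationSigma rfl)
    have := this.integral_mul_eq_mul_integral (hη.measurable c t).aestronglyMeasurable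
      (hη.measurable c' t).aestronglyMeasurable
    simpa [hη.mean_zero] using this

/-- The filtration at step `s` omits just the times of coordinate `c` still to be visited by `φ`, so
the path may run forwards or backwards. Keeping to one coordinate makes the resulting maxima
independent across coordinates. -/
theorem isIndepDiff_innovation [IsProbabilityMeasure P] (hη : IsInnovationArray P η)
    {φ : ℕ → ℤ} (hφ : Function.Injective φ) (a c : ℕ) :
    IsIndepDiff P (fun s => innovationSigma η {i | i.1 = c ∧ i.2 ∉ φ '' Set.Ico s a})
      (fun s => η c (φ s)) a (∫ ω, η 0 0 ω ^ 4 ∂P) where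
  mono s s' h := innovationSigma_mono fun i hi =>
    ⟨hi.1, fun h' => hi.2 (Set.image_mono (Set.Ico_subset_Ico_left h) h')⟩
  le s := innovationSigma_le hη _
  meas s hs := measurable_innovationSigma ⟨rfl, by
    rintro ⟨s', hs', he⟩
    have := hφ he
    have := hs'.1
    omega⟩
  memLp s _ := hη.fourth_moment c _
  indep s hs := by
    refine indep_of_indep_of_le_right (indep_innovationSigma hη (T := {(c, φ s)}) ?_)
      (measurable_innovationSigma (S := {(c, φ s)}) rfl).comap_le
    rw [Set.disjoint_singleton_right]
    exact fun h => h.2 ⟨s, ⟨le_rfl, hs⟩, rfl⟩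
  mean s _ := hη.mean_zero c _
  second s _ := integral_innovation_sq hη c _
  fourth s _ :=
    ((hη.identDistrib c (φ s)).comp (u := fun x : ℝ => x ^ 4) (by fun_prop)).integral_eq.le

variable [IsProbabilityMeasure P]

theorem measurable_maxSq_innovation (hη : IsInnovationArray P η) {φ : ℕ → ℤ}
    (hφ : Function.Injective φ) (a c : ℕ) :
    Measurable[innovationSigma η {i | i.1 = c}] fun ω => maxSq (fun s => η c (φ s) ω) a := by
  have h := isIndepDiff_innovation hη hφ a c
  have h1 := h.isMartingaleDiff.measurable_runningMax le_rfl
  have h2 := h.neg.isMartingaleDiff.measurable_runningMax le_rfl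
  exact (((h1.pow_const 2).add (h2.pow_const 2)).mono
    (innovationSigma_mono fun i hi => hi.1) le_rfl)

theorem measurable_innovationMaxSq (hη : IsInnovationArray P η) (p : ℕ) {φ : ℕ → ℤ}
    (hφ : Function.Injective φ) (a : ℕ) : Measurable (innovationMaxSq η p φ a) :=
  Finset.measurable_sum _ fun c _ =>
    (measurable_maxSq_innovation hη hφ a c).mono (innovationSigma_le hη _) le_rfl

theorem memLp_innovationMaxSq (hη : IsInnovationArray P η) (p : ℕ) {φ : ℕ → ℤ}
    (hφ : Function.Injective φ) (a : ℕ) : MemLp (innovationMaxSq η p φ a) 2 P :=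
  memLp_finsetSum _ fun c _ => (isIndepDiff_innovation hη hφ a c).memLp_maxSq

theorem integral_innovationMaxSq_le (hη : IsInnovationArray P η) (p : ℕ) {φ : ℕ → ℤ}
    (hφ : Function.Injective φ) (a : ℕ) : ∫ ω, innovationMaxSq η p φ a ω ∂P ≤ 8 * a * p := by
  unfold innovationMaxSq
  rw [integral_finsetSum _ fun (c : Fin p) _ =>
    (isIndepDiff_innovation hη hφ a c).memLp_maxSq.integrable (by norm_num)]
  refine (Finset.sum_le_sum fun (c : Fin p) _ =>
    (isIndepDiff_innovation hη hφ a c).integral_maxSq_le).trans_eq ?_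
  simp [mul_comm]

/-- Variances add over independent coordinates, so the bound is linear in `p`; this is what allows a
union bound over many blocks under (SNR). -/
theorem variance_innovationMaxSq_le (hη : IsInnovationArray P η) (p : ℕ) {φ : ℕ → ℤ}
    (hφ : Function.Injective φ) (a : ℕ) :
    variance (innovationMaxSq η p φ a) P ≤ p * ((88 + 66 * ∫ ω, η 0 0 ω ^ 4 ∂P) * a ^ 2) := by
  have e : innovationMaxSq η p φ a =
      ∑ c : Fin p, fun ω => maxSq (fun s => η c (φ s) ω) a := by
    ext ω; simp [innovationMaxSq]
  rw [e, IndepFun.variance_sum fun (c : Fin p) _ => (isIndepDiff_innovation hη hφ a c).memLp_maxSq]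
  · refine (Finset.sum_le_sum (g := fun _ => (88 + 66 * ∫ ω, η 0 0 ω ^ 4 ∂P) * (a : ℝ) ^ 2)
      fun c _ => ?_).trans_eq (by simp)
    have h := isIndepDiff_innovation hη hφ a c
    exact (variance_le_expectation_sq h.memLp_maxSq.aestronglyMeasurable).trans
      h.integral_maxSq_sq_le
  · intro c _ c' _ hcc
    refine indepFun_innovationSigma hη ?_ (measurable_maxSq_innovation hη hφ a c)
      (measurable_maxSq_innovation hη hφ a c')
    rw [Set.disjoint_left]
    rintro i (hi : i.1 = c) (hi' : i.1 = c')
    exact hcc (Fin.ext (hi.symm.trans hi'))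

/-- The sum over a finite set of times of the innovation vectors has second moment `|T| p`. -/
theorem integral_norm_sq_sum_innovation (hη : IsInnovationArray P η) (p : ℕ) (T : Finset ℤ) :
    ∫ ω, ‖∑ t ∈ T, innovation η p t ω‖ ^ 2 ∂P = T.card * p := by
  have hm : ∀ c : Fin p, MemLp (fun ω => ∑ t ∈ T, η c t ω) 2 P := fun c =>
    memLp_finsetSum _ fun t _ => memLp_two_innovation hη c t
  simp_rw [EuclideanSpace.real_norm_sq_eq, sum_innovation_apply p (fun t => t)]
  rw [integral_finsetSum _ fun c _ => (hm c).integrable_sq]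
  have : ∀ c : Fin p, ∫ ω, (∑ t ∈ T, η c t ω) ^ 2 ∂P = T.card := by
    intro c
    rw [← variance_of_integral_eq_zero (hm c).aestronglyMeasurable.aemeasurable]
    · have e : (fun ω => ∑ t ∈ T, η c t ω) = ∑ t ∈ T, η c t := by ext; simp
      rw [e, IndepFun.variance_sum fun t _ => memLp_two_innovation hη c t]
      · simp [hη.variance_one]
      · intro t _ t' _ h
        exact indepFun_innovationSigma hη (S := {((c : ℕ), t)}) (T := {((c : ℕ), t')})
          (by simp [h]) (measurable_innovationSigma rfl) (measurable_innovationSigma rfl)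
    · rw [integral_finsetSum _ fun t _ => (memLp_two_innovation hη c t).integrable (by norm_num)]
      simp [hη.mean_zero]
  simp [this, mul_comm]

theorem memLp_sum_innovation (hη : IsInnovationArray P η) (p : ℕ) (T : Finset ℤ) :
    MemLp (fun ω => ∑ t ∈ T, innovation η p t ω) 2 P := by
  refine memLp_finsetSum _ fun t _ => ?_
  rw [memLp_two_iff_integrable_sq_norm ((measurable_innovation_sigma η (S := Set.univ) p
    fun _ => trivial).mono (innovationSigma_le hη _) le_rfl).aestronglyMeasurable]
  simp_rw [EuclideanSpace.real_norm_sq_eq]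
  exact integrable_finsetSum _ fun c _ => (memLp_two_innovation hη c t).integrable_sq

/-- Inner products of future innovation vectors with a vector that is independent of them. -/
theorem isMartingaleDiff_inner_innovation (hη : IsInnovationArray P η) {p : ℕ} {φ : ℕ → ℤ}
    (hφ : Function.Injective φ) (a : ℕ) {g : Ω → EuclideanSpace ℝ (Fin p)}
    (hg : Measurable[innovationSigma η {i | i.2 ∉ φ '' Set.Ico 0 a}] g) (hg2 : MemLp g 2 P) :
    IsMartingaleDiff P (fun s => innovationSigma η {i | i.2 ∉ φ '' Set.Ico s a})
        (fun s ω => inner ℝ (g ω) (innovation η p (φ s) ω)) a ∧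
      ∀ s < a, ∫ ω, inner ℝ (g ω) (innovation η p (φ s) ω) ^ 2 ∂P = ∫ ω, ‖g ω‖ ^ 2 ∂P := by
  -- Here the filtration contains all innovations, past and future, whose times are not still ahead
  -- on the path. In particular `g` is known from the start.
  set F : ℕ → MeasurableSpace Ω := fun s => innovationSigma η {i | i.2 ∉ φ '' Set.Ico s a}
    with hF
  have hmono : Monotone F := fun s s' h => innovationSigma_mono fun i hi h' =>
    hi (Set.image_mono (Set.Ico_subset_Ico_left h) h')
  have hle : ∀ s, F s ≤ mΩ := fun s => innovationSigma_le hη _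
  have hgc : ∀ s (c : Fin p), Measurable[F s] fun ω => g ω c := fun s c =>
    ((EuclideanSpace.proj (𝕜 := ℝ) c).continuous.measurable.comp
      (hg.mono (hmono (Nat.zero_le s)) le_rfl))
  have hgc2 : ∀ c : Fin p, MemLp (fun ω => g ω c) 2 P := fun c =>
    hg2.of_le ((hgc 0 c).mono (hle 0) le_rfl).aestronglyMeasurable
      (Eventually.of_forall fun ω => PiLp.norm_apply_le _ _)
  have hdisj : ∀ s < a, Disjoint {i : ℕ × ℤ | i.2 ∉ φ '' Set.Ico s a} {i | i.2 = φ s} := by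
    intro s hs
    rw [Set.disjoint_left]
    rintro i hi (hi' : i.2 = φ s)
    exact hi ⟨s, ⟨le_rfl, hs⟩, hi'.symm⟩
  have hind : ∀ s < a, ∀ f h : Ω → ℝ, Measurable[F s] f →
      Measurable[innovationSigma η {i | i.2 = φ s}] h → IndepFun f h P :=
    fun s hs f h hf hh => indepFun_innovationSigma hη (hdisj s hs) hf hh
  have hηm : ∀ s (c : ℕ), Measurable[innovationSigma η {i | i.2 = φ s}] (η c (φ s)) :=
    fun s c => measurable_innovationSigma rfl
  have hmul : ∀ s < a, ∀ f h : Ω → ℝ, Measurable[F s] f →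
      Measurable[innovationSigma η {i | i.2 = φ s}] h →
      ∫ ω, f ω * h ω ∂P = (∫ ω, f ω ∂P) * ∫ ω, h ω ∂P := fun s hs f h hf hh =>
    (hind s hs f h hf hh).integral_mul_eq_mul_integral
      (hf.mono (hle s) le_rfl).aestronglyMeasurable
      (hh.mono (innovationSigma_le hη _) le_rfl).aestronglyMeasurable
  have hinner : ∀ s ω, inner ℝ (g ω) (innovation η p (φ s) ω) =
      ∑ c : Fin p, g ω c * η c (φ s) ω := by
    intro s ω
    simp [PiLp.inner_apply, innovation, mul_comm]
  have hterm : ∀ s < a, ∀ c : Fin p, MemLp (fun ω => g ω c * η c (φ s) ω) 2 P := by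
    intro s hs c
    have hmeas : AEStronglyMeasurable (fun ω => g ω c * η c (φ s) ω) P :=
      (((hgc 0 c).mono (hle 0) le_rfl).mul (hη.measurable c _)).aestronglyMeasurable
    rw [memLp_two_iff_integrable_sq hmeas]
    have := (hind s hs _ _ ((hgc s c).pow_const 2) ((hηm s c).pow_const 2)).integrable_mul
      (hgc2 c).integrable_sq (memLp_two_innovation hη c _).integrable_sq
    exact this.congr (Eventually.of_forall fun ω => by simp [mul_pow])
  have hmem : ∀ s < a, MemLp (fun ω => inner ℝ (g ω) (innovation η p (φ s) ω)) 2 P := by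
    intro s hs
    simp_rw [hinner]
    exact memLp_finsetSum _ fun c _ => hterm s hs c
  refine ⟨⟨hmono, hle, fun s hs => ?_, hmem, fun s hs Y hY hY2 => ?_⟩, fun s hs => ?_⟩
  · have h1 : Measurable[F (s + 1)] (innovation η p (φ s)) :=
      measurable_innovation_sigma η p fun c => by
        rintro ⟨s', hs', he⟩
        have := hφ he
        have := hs'.1
        omega
    exact (hg.mono (hmono (Nat.zero_le _)) le_rfl).inner h1
  · simp_rw [hinner, Finset.mul_sum]
    rw [integral_finsetSum _ fun (c : Fin p) _ => by
      exact hY2.integrable_mul (hterm s hs c)]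
    refine Finset.sum_eq_zero fun c _ => ?_
    simp_rw [← mul_assoc]
    rw [hmul s hs (fun ω => Y ω * g ω c) _ (hY.mul (hgc s c)) (hηm s c), hη.mean_zero, mul_zero]
  · have e : ∀ ω, inner ℝ (g ω) (innovation η p (φ s) ω) ^ 2 =
        ∑ c : Fin p, ∑ c' : Fin p,
          (g ω c * g ω c') * (η c (φ s) ω * η c' (φ s) ω) := by
      intro ω
      rw [hinner, sq, Finset.sum_mul_sum]
      refine Finset.sum_congr rfl fun c _ => Finset.sum_congr rfl fun c' _ => by ring
    have hint : ∀ c c' : Fin p, Integrable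
        (fun ω => (g ω c * g ω c') * (η c (φ s) ω * η c' (φ s) ω)) P := fun c c' =>
      ((hterm s hs c).integrable_mul (hterm s hs c')).congr
        (Eventually.of_forall fun ω => by simp only [Pi.mul_apply]; ring)
    simp_rw [e]
    rw [integral_finsetSum _ fun c _ => integrable_finsetSum _ fun c' _ => hint c c']
    simp_rw [EuclideanSpace.real_norm_sq_eq]
    rw [integral_finsetSum _ fun c _ => (hgc2 c).integrable_sq]
    refine Finset.sum_congr rfl fun c _ => ?_
    rw [integral_finsetSum _ fun c' _ => hint c c']
    -- The innovation vector has identity covariance and is independent of `g`, so only the diagonal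
    -- terms survive.
    have hcc : ∀ c' : Fin p, ∫ ω, (g ω c * g ω c') * (η c (φ s) ω * η c' (φ s) ω) ∂P =
        (∫ ω, g ω c * g ω c' ∂P) * if c = c' then 1 else 0 := fun c' => by
      rw [hmul s hs (fun ω => g ω c * g ω c') (fun ω => η c (φ s) ω * η c' (φ s) ω)
        ((hgc s c).mul (hgc s c')) ((hηm s c).mul (hηm s c')), integral_innovation_mul hη]
      simp only [Fin.val_inj]
    simp [hcc, sq]

/-- The maximal inequality for the inner products of partial sums of innovation vectors with an
independent vector. -/
theorem lintegral_maxSq_inner_le (hη : IsInnovationArray P η) {p : ℕ} {φ : ℕ → ℤ}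
    (hφ : Function.Injective φ) (a : ℕ) {g : Ω → EuclideanSpace ℝ (Fin p)}
    (hg : Measurable[innovationSigma η {i | i.2 ∉ φ '' Set.Ico 0 a}] g) (hg2 : MemLp g 2 P) :
    Measurable (fun ω => maxSq (fun s => inner ℝ (g ω) (innovation η p (φ s) ω)) a) ∧
    ∫⁻ ω, ENNReal.ofReal (maxSq (fun s => inner ℝ (g ω) (innovation η p (φ s) ω)) a) ∂P ≤
      ENNReal.ofReal (8 * a * ∫ ω, ‖g ω‖ ^ 2 ∂P) := by
  obtain ⟨h, h2⟩ := isMartingaleDiff_inner_innovation hη hφ a hg hg2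
  refine ⟨(((h.measurable_runningMax le_rfl).pow_const 2).add
    ((h.neg.measurable_runningMax le_rfl).pow_const 2)).mono (h.le a) le_rfl, ?_⟩
  rw [← ofReal_integral_eq_lintegral_ofReal h.integrable_maxSq
    (Eventually.of_forall fun ω => maxSq_nonneg _ _)]
  refine ENNReal.ofReal_le_ofReal (h.integral_maxSq_le.trans_eq ?_)
  rw [Finset.sum_congr rfl fun s hs => h2 s (Finset.mem_range.1 hs)]
  simp [mul_assoc]

end Innovations

/-! ### Weighted sums of nonnegative extended random variables -/

theorem ENNReal.two_mul_mul_le_sq_add_sq (x y : ℝ≥0∞) : 2 * (x * y) ≤ x ^ 2 + y ^ 2 := by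
  induction x using ENNReal.recTopCoe with
  | top => simp
  | coe x =>
    induction y using ENNReal.recTopCoe with
    | top => simp
    | coe y =>
      have : 2 * (x * y) ≤ x ^ 2 + y ^ 2 := by
        have := two_mul_le_add_sq x y
        rwa [mul_assoc] at this
      exact_mod_cast this

theorem ENNReal.sq_tsum_mul_le {ι : Type*} (w x : ι → ℝ≥0∞) :
    (∑' i, w i * x i) ^ 2 ≤ (∑' i, w i) * ∑' i, w i * x i ^ 2 := by
  -- The doubled inequality follows by symmetrizing over `i`, `j` and avoids subtraction in `ℝ≥0∞`;
  -- the factor is cancelled at the end.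
  have h : 2 * (∑' i, w i * x i) ^ 2 ≤ 2 * ((∑' i, w i) * ∑' i, w i * x i ^ 2) := by
    calc 2 * (∑' i, w i * x i) ^ 2
        = ∑' i, ∑' j, w i * w j * (2 * (x i * x j)) := by
          rw [sq, ← ENNReal.tsum_mul_right, ← ENNReal.tsum_mul_left]
          refine tsum_congr fun i => ?_
          rw [← ENNReal.tsum_mul_left, ← ENNReal.tsum_mul_left]
          exact tsum_congr fun j => by ring
      _ ≤ ∑' i, ∑' j, (w j * (w i * x i ^ 2) + w i * (w j * x j ^ 2)) := by
          refine ENNReal.tsum_le_tsum fun i => ENNReal.tsum_le_tsum fun j => ?_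
          refine (mul_le_mul_right (ENNReal.two_mul_mul_le_sq_add_sq _ _) _).trans_eq (by ring)
      _ = _ := by
          simp_rw [ENNReal.tsum_add, ENNReal.tsum_mul_left, ENNReal.tsum_mul_right]
          rw [ENNReal.tsum_mul_left]
          ring
  exact (ENNReal.mul_le_mul_iff_right two_ne_zero ENNReal.ofNat_ne_top).1 h

theorem lintegral_sq_tsum_mul_le {Ω ι : Type*} [MeasurableSpace Ω] [Countable ι] {P : Measure Ω}
    (w : ι → ℝ≥0∞) {x : ι → Ω → ℝ≥0∞} (hx : ∀ i, Measurable (x i)) {C : ℝ≥0∞}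
    (hC : ∀ i, ∫⁻ ω, x i ω ^ 2 ∂P ≤ C) :
    ∫⁻ ω, (∑' i, w i * x i ω) ^ 2 ∂P ≤ (∑' i, w i) ^ 2 * C := by
  calc _ ≤ ∫⁻ ω, (∑' i, w i) * ∑' i, w i * x i ω ^ 2 ∂P :=
        lintegral_mono fun ω => ENNReal.sq_tsum_mul_le _ _
    _ = (∑' i, w i) * ∑' i, w i * ∫⁻ ω, x i ω ^ 2 ∂P := by
        rw [lintegral_const_mul _ (Measurable.tsum fun i =>
          ((hx i).pow_const 2).const_mul _), lintegral_tsum fun i =>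
          (((hx i).pow_const 2).const_mul _).aemeasurable]
        simp_rw [fun i => lintegral_const_mul (w i) ((hx i).pow_const 2) (μ := P)]
    _ ≤ (∑' i, w i) * ∑' i, w i * C := by
        gcongr with i
        exact hC i
    _ = _ := by rw [ENNReal.tsum_mul_right]; ring

theorem integral_norm_sq_map_le {Ω E F : Type*} [MeasurableSpace Ω] {P : Measure Ω} [NormedAddCommGroup E] [NormedSpace ℝ E]
    [NormedAddCommGroup F] [NormedSpace ℝ F] {B : E →L[ℝ] F} (hB : ‖B‖ ≤ 1)
    {f : Ω → E} (hf : MemLp f 2 P) : ∫ ω, ‖B (f ω)‖ ^ 2 ∂P ≤ ∫ ω, ‖f ω‖ ^ 2 ∂P := by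
  refine integral_mono_of_nonneg (Eventually.of_forall fun ω => by positivity)
    ((memLp_two_iff_integrable_sq_norm hf.1).1 hf) (Eventually.of_forall fun ω => ?_)
  have := B.le_of_opNorm_le hB (f ω)
  rw [one_mul] at this
  simp only
  gcongr

/-! ### Partial sums of linear processes -/

section LinearProcess

variable {Ω : Type*} {p : ℕ}

/-- The linear process with coefficient operators `T` and innovations `η`. -/
noncomputable def linearProcess
    (T : ℕ → EuclideanSpace ℝ (Fin p) →L[ℝ] EuclideanSpace ℝ (Fin p))
    (η : ℕ → ℤ → Ω → ℝ) (t : ℤ) (ω : Ω) : EuclideanSpace ℝ (Fin p) :=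
  ∑' j : ℕ, T j (innovation η p (t - j) ω)

/-- The series defining a linear process converges absolutely at all times. -/
def LinearSummable (T : ℕ → EuclideanSpace ℝ (Fin p) →L[ℝ] EuclideanSpace ℝ (Fin p))
    (η : ℕ → ℤ → Ω → ℝ) (ω : Ω) : Prop :=
  ∀ t : ℤ, Summable fun j : ℕ => ‖T j (innovation η p (t - j) ω)‖

variable {T : ℕ → EuclideanSpace ℝ (Fin p) →L[ℝ] EuclideanSpace ℝ (Fin p)}
  {η : ℕ → ℤ → Ω → ℝ}

theorem hasSum_sum_linearProcess {ι : Type*} (θ : ι → ℤ) (s : Finset ι) {ω : Ω}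
    (hω : LinearSummable T η ω) :
    HasSum (fun j : ℕ => T j (∑ i ∈ s, innovation η p (θ i - j) ω))
      (∑ i ∈ s, linearProcess T η (θ i) ω) := by
  simp_rw [map_sum]
  exact hasSum_sum fun i _ => (hω (θ i)).of_norm.hasSum

/-- A continuous linear operator divided by its norm. -/
noncomputable def normalizedOp {E : Type*} [NormedAddCommGroup E] [NormedSpace ℝ E]
    (T : E →L[ℝ] E) : E →L[ℝ] E :=
  ‖T‖⁻¹ • T

theorem norm_smul_normalizedOp {E : Type*} [NormedAddCommGroup E] [NormedSpace ℝ E]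
    (T : E →L[ℝ] E) : ‖T‖ • normalizedOp T = T := by
  rcases eq_or_ne T 0 with rfl | h
  · simp
  · rw [normalizedOp, smul_smul, mul_inv_cancel₀ (norm_ne_zero_iff.2 h), one_smul]

theorem norm_normalizedOp_le {E : Type*} [NormedAddCommGroup E] [NormedSpace ℝ E]
    (T : E →L[ℝ] E) : ‖normalizedOp T‖ ≤ 1 := by
  rw [normalizedOp, norm_smul, norm_inv, norm_norm]
  exact inv_mul_le_one

/-- Pulls out the summable weight `‖T‖` and leaves an operator of norm at most one, so that moment
bounds are uniform over lags. -/
theorem enorm_inner_eq {E : Type*} [NormedAddCommGroup E] [InnerProductSpace ℝ E]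
    (T : E →L[ℝ] E) (v x : E) :
    ‖(inner ℝ v (T x) : ℝ)‖ₑ = ‖T‖ₑ * ‖(inner ℝ v (normalizedOp T x) : ℝ)‖ₑ := by
  conv_lhs => rw [← norm_smul_normalizedOp T]
  rw [smul_apply, inner_smul_right, enorm_mul]
  simp

theorem enorm_inner_tsum_le {E : Type*} [NormedAddCommGroup E] [InnerProductSpace ℝ E]
    (v : E) {f : ℕ → E} {x : E} (h : HasSum f x) :
    ‖(inner ℝ v x : ℝ)‖ₑ ≤ ∑' j, ‖(inner ℝ v (f j) : ℝ)‖ₑ := by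
  have : HasSum (fun j => (inner ℝ v (f j) : ℝ)) (inner ℝ v x) := h.mapL (innerSL ℝ v)
  rw [← this.tsum_eq]
  exact enorm_tsum_le_tsum_enorm

/-- A path of times which traverses every interval in consecutive steps. -/
structure IsTimePath (θ : ℕ → ℤ) : Prop where
  injective : Function.Injective θ
  interval : ∀ (l h : ℤ) (a : ℕ), ∃ s₁ s₂, s₁ ≤ s₂ ∧ s₂ ≤ a ∧
    (Finset.range a).filter (fun s => θ s ∈ Finset.Icc l h) = Finset.Ico s₁ s₂

/-- The forward path serves splits to the right of the change point, the backward path below those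
to its left. -/
theorem isTimePath_add (e : ℤ) : IsTimePath fun s => e + s where
  injective s s' h := by simpa using h
  interval l h a := by
    refine ⟨min a (l - e).toNat, max (min a (l - e).toNat) (min a (h + 1 - e).toNat),
      le_max_left _ _, by omega, ?_⟩
    ext s
    simp only [Finset.mem_filter, Finset.mem_range, Finset.mem_Icc, Finset.mem_Ico]
    omega

theorem isTimePath_sub (e : ℤ) : IsTimePath fun s => e - s where
  injective s s' h := by simpa using h
  interval l h a := by
    refine ⟨min a (e - h).toNat, max (min a (e - h).toNat) (min a (e + 1 - l).toNat),
      le_max_left _ _, by omega, ?_⟩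
    ext s
    simp only [Finset.mem_filter, Finset.mem_range, Finset.mem_Icc, Finset.mem_Ico]
    omega

theorem IsTimePath.injective_sub {θ : ℕ → ℤ} (hθ : IsTimePath θ) (j : ℕ) :
    Function.Injective fun s => θ s - (j : ℤ) :=
  fun _ _ h => hθ.injective (sub_left_injective h)

-- The window sum at lag `i` is split by whether an innovation lies on the first `a` steps of the
-- path at lag `j`. Those that do are visited consecutively, hence form a difference of two partial
-- sums along the path.
open scoped Classical in
theorem sum_innovation_eq_in_add_out {θ : ℕ → ℤ} (hθ : IsTimePath θ) (l h : ℤ) (a i j : ℕ) :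
    ∃ s₁ s₂ : ℕ, s₁ ≤ a ∧ s₂ ≤ a ∧ ∀ ω : Ω,
      ∑ t ∈ Finset.Icc l h, innovation η p (t - i) ω =
        (∑ s ∈ Finset.range s₂, innovation η p (θ s - j) ω -
          ∑ s ∈ Finset.range s₁, innovation η p (θ s - j) ω) +
        ∑ u ∈ (Finset.Icc (l - i) (h - i)).filter
          (fun u => u ∉ (fun s => θ s - (j : ℤ)) '' Set.Ico 0 a), innovation η p u ω := by
  obtain ⟨s₁, s₂, h12, h2a, hs⟩ := hθ.interval (l - i + j) (h - i + j) a
  refine ⟨s₁, s₂, h12.trans h2a, h2a, fun ω => ?_⟩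
  rw [← Finset.sum_Ico_eq_sub _ h12, ← hs]
  have e1 : ∑ t ∈ Finset.Icc l h, innovation η p (t - i) ω =
      ∑ u ∈ Finset.Icc (l - i) (h - i), innovation η p u ω := by
    refine Finset.sum_bij (fun t _ => t - i) ?_ ?_ ?_ fun _ _ => rfl
    · intro t ht; simp only [Finset.mem_Icc] at ht ⊢; omega
    · intro t _ t' _ h; exact sub_left_injective h
    · intro u hu
      simp only [Finset.mem_Icc] at hu
      exact ⟨u + i, by simp only [Finset.mem_Icc]; omega, by ring⟩
  rw [e1, ← Finset.sum_filter_add_sum_filter_not (Finset.Icc (l - (i : ℤ)) (h - i))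
    (fun u => u ∈ (fun s => θ s - (j : ℤ)) '' Set.Ico 0 a)]
  congr 1
  refine (Finset.sum_bij (fun s _ => θ s - (j : ℤ)) ?_ ?_ ?_ fun _ _ => rfl).symm
  · intro s hs
    simp only [Finset.mem_filter, Finset.mem_range, Finset.mem_Icc] at hs ⊢
    exact ⟨by omega, s, ⟨Nat.zero_le _, hs.1⟩, rfl⟩
  · intro s _ s' _ h
    exact hθ.injective_sub j h
  · intro u hu
    simp only [Finset.mem_filter, Finset.mem_Icc] at hu
    obtain ⟨hu, s, hs, rfl⟩ := hu
    refine ⟨s, ?_, rfl⟩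
    simp only [Finset.mem_filter, Finset.mem_range, Finset.mem_Icc]
    have := hs.2
    simp only at hu
    omega

/-- The random weight `Γ ∑ⱼ ‖Tⱼ‖ Zⱼ`, where `Zⱼ` majorizes the squared norms of the first `a`
partial sums of the innovation vectors along the path `θ` lagged by `j`. -/
noncomputable def weightedMaxSq
    (T : ℕ → EuclideanSpace ℝ (Fin p) →L[ℝ] EuclideanSpace ℝ (Fin p))
    (η : ℕ → ℤ → Ω → ℝ) (θ : ℕ → ℤ) (a : ℕ) (ω : Ω) : ℝ≥0∞ :=
  (∑' j, ‖T j‖ₑ) * ∑' j : ℕ, ‖T j‖ₑ *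
    ENNReal.ofReal (innovationMaxSq η p (fun s => θ s - (j : ℤ)) a ω)

theorem enorm_sq_sum_linearProcess_le (θ : ℕ → ℤ) {d a : ℕ} (hd : d ≤ a) {ω : Ω}
    (hω : LinearSummable T η ω) :
    ‖∑ s ∈ Finset.range d, linearProcess T η (θ s) ω‖ₑ ^ 2 ≤ weightedMaxSq T η θ a ω := by
  rw [← (hasSum_sum_linearProcess θ (Finset.range d) hω).tsum_eq]
  calc _ ≤ (∑' j : ℕ, ‖T j‖ₑ * ‖∑ s ∈ Finset.range d, innovation η p (θ s - j) ω‖ₑ) ^ 2 := by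
        gcongr
        refine enorm_tsum_le_tsum_enorm.trans (ENNReal.tsum_le_tsum fun j => ?_)
        exact (T j).le_opENorm _
    _ ≤ _ := ENNReal.sq_tsum_mul_le _ _
    _ ≤ _ := by
        unfold weightedMaxSq
        gcongr with j
        rw [← ofReal_norm, ← ENNReal.ofReal_pow (norm_nonneg _)]
        exact ENNReal.ofReal_le_ofReal
          (norm_sq_sum_innovation_le p (fun s => θ s - (j : ℤ)) hd ω)

theorem enorm_le_ofReal_sqrt {x y : ℝ} (h : x ^ 2 ≤ y) : ‖x‖ₑ ≤ ENNReal.ofReal (Real.sqrt y) := by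
  rw [Real.enorm_eq_ofReal_abs]
  exact ENNReal.ofReal_le_ofReal (Real.abs_le_sqrt h)

theorem ofReal_sqrt_sq {y : ℝ} (h : 0 ≤ y) :
    ENNReal.ofReal (Real.sqrt y) ^ 2 = ENNReal.ofReal y := by
  rw [← ENNReal.ofReal_pow (Real.sqrt_nonneg _), Real.sq_sqrt h]

variable [mΩ : MeasurableSpace Ω] {P : Measure Ω} [IsProbabilityMeasure P]

/-- At every lag the window contains equally many distinct times, so the second moment of the
innovation sum is the same and the weighted Cauchy–Schwarz bound applies. Like the later majorants,
`H` is measurable, ready for Chebyshev's inequality. -/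
theorem exists_majorant_norm_sum (hη : IsInnovationArray P η)
    (hs : ∀ᵐ ω ∂P, LinearSummable T η ω) (l h : ℤ) :
    ∃ H : Ω → ℝ≥0∞, Measurable H ∧
      ∫⁻ ω, H ω ^ 2 ∂P ≤ (∑' j, ‖T j‖ₑ) ^ 2 * ENNReal.ofReal ((Finset.Icc l h).card * p) ∧
      ∀ᵐ ω ∂P, ‖∑ t ∈ Finset.Icc l h, linearProcess T η t ω‖ₑ ≤ H ω := by
  have hm : ∀ j : ℕ, MemLp (fun ω => ∑ t ∈ Finset.Icc l h, innovation η p (t - j) ω) 2 P ∧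
      ∫ ω, ‖∑ t ∈ Finset.Icc l h, innovation η p (t - j) ω‖ ^ 2 ∂P =
        (Finset.Icc l h).card * p := by
    intro j
    have hinj : Set.InjOn (fun t : ℤ => t - j) (Finset.Icc l h) := sub_left_injective.injOn
    have h1 := memLp_sum_innovation hη p ((Finset.Icc l h).image fun t => t - (j : ℤ))
    have h2 := integral_norm_sq_sum_innovation hη p ((Finset.Icc l h).image fun t => t - (j : ℤ))
    simp_rw [Finset.sum_image hinj] at h1 h2
    rw [Finset.card_image_of_injOn hinj] at h2
    exact ⟨h1, h2⟩
  have hmeas : ∀ j : ℕ, Measurable fun ω => ∑ t ∈ Finset.Icc l h, innovation η p (t - j) ω :=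
    fun j => Finset.measurable_sum _ fun t _ => (measurable_innovation_sigma η (S := Set.univ) p
      fun _ => trivial).mono (innovationSigma_le hη _) le_rfl
  refine ⟨fun ω => ∑' j : ℕ, ‖T j‖ₑ * ‖∑ t ∈ Finset.Icc l h, innovation η p (t - j) ω‖ₑ,
    Measurable.tsum fun j => (hmeas j).enorm.const_mul _,
    lintegral_sq_tsum_mul_le _ (fun j => (hmeas j).enorm) fun j => ?_, ?_⟩
  · rw [← (hm j).2, ofReal_integral_eq_lintegral_ofReal
      ((memLp_two_iff_integrable_sq_norm (hm j).1.1).1 (hm j).1)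
      (Eventually.of_forall fun ω => by positivity)]
    refine lintegral_mono fun ω => ?_
    rw [ENNReal.ofReal_pow (norm_nonneg _), ofReal_norm]
  · filter_upwards [hs] with ω hω
    rw [← (hasSum_sum_linearProcess (fun t => t) (Finset.Icc l h) hω).tsum_eq]
    exact enorm_tsum_le_tsum_enorm.trans (ENNReal.tsum_le_tsum fun j => (T j).le_opENorm _)

/-- Moving the normalized operator to `v` by its adjoint leaves, at each lag, a scalar martingale
with increments of second moment at most `‖v‖ ^ 2`. -/
theorem exists_majorant_inner_const (hη : IsInnovationArray P η)
    (hs : ∀ᵐ ω ∂P, LinearSummable T η ω) {θ : ℕ → ℤ} (hθ : IsTimePath θ) (a : ℕ)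
    (v : EuclideanSpace ℝ (Fin p)) :
    ∃ H : Ω → ℝ≥0∞, Measurable H ∧
      ∫⁻ ω, H ω ^ 2 ∂P ≤ (∑' j, ‖T j‖ₑ) ^ 2 * ENNReal.ofReal (8 * a * ‖v‖ ^ 2) ∧
      ∀ᵐ ω ∂P, ∀ d ≤ a,
        ‖(inner ℝ v (∑ s ∈ Finset.range d, linearProcess T η (θ s) ω) : ℝ)‖ₑ ≤ H ω := by
  set g : ℕ → EuclideanSpace ℝ (Fin p) := fun j =>
    (normalizedOp (T j)).adjoint v with hg
  have hgn : ∀ j, ‖g j‖ ≤ ‖v‖ := by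
    intro j
    have h1 : ‖(normalizedOp (T j)).adjoint‖ ≤ 1 := by
      rw [LinearIsometryEquiv.norm_map]; exact norm_normalizedOp_le _
    have := ContinuousLinearMap.le_of_opNorm_le _ h1 v
    rwa [one_mul] at this
  set q : ℕ → Ω → ℝ := fun j ω =>
    maxSq (fun s => inner ℝ (g j) (innovation η p (θ s - j) ω)) a with hq
  have key := fun j : ℕ => lintegral_maxSq_inner_le hη (hθ.injective_sub j) a
    (g := fun _ => g j) measurable_const (memLp_const _)
  refine ⟨fun ω => ∑' j : ℕ, ‖T j‖ₑ * ENNReal.ofReal (Real.sqrt (q j ω)),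
    Measurable.tsum fun j => ((key j).1.sqrt.ennreal_ofReal).const_mul _,
    lintegral_sq_tsum_mul_le _ (fun j => (key j).1.sqrt.ennreal_ofReal) fun j => ?_, ?_⟩
  · refine (lintegral_congr fun ω => ofReal_sqrt_sq (maxSq_nonneg _ _)).trans_le ?_
    refine (key j).2.trans (ENNReal.ofReal_le_ofReal ?_)
    simp only [integral_const, probReal_univ, one_smul]
    gcongr
    exact hgn j
  · filter_upwards [hs] with ω hω d hd
    refine (enorm_inner_tsum_le v (hasSum_sum_linearProcess θ (Finset.range d) hω)).trans
      (ENNReal.tsum_le_tsum fun j => ?_)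
    rw [enorm_inner_eq]
    gcongr
    refine enorm_le_ofReal_sqrt ?_
    rw [← ContinuousLinearMap.adjoint_inner_left, inner_sum]
    exact sq_sum_range_le_maxSq (fun s => inner ℝ (g j) (innovation η p (θ s - j) ω)) hd

/-- Mean plus fluctuation: the mean is controlled by (SNR), the fluctuation `H` by the variance
linear in `p`. -/
theorem exists_majorant_weightedMaxSq (hη : IsInnovationArray P η) {θ : ℕ → ℤ}
    (hθ : IsTimePath θ) (a : ℕ) :
    ∃ H : Ω → ℝ≥0∞, Measurable H ∧
      ∫⁻ ω, H ω ^ 2 ∂P ≤ (∑' j, ‖T j‖ₑ) ^ 4 *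
        ENNReal.ofReal (p * ((88 + 66 * ∫ ω, η 0 0 ω ^ 4 ∂P) * a ^ 2)) ∧
      ∀ ω, weightedMaxSq T η θ a ω ≤
        (∑' j, ‖T j‖ₑ) ^ 2 * ENNReal.ofReal (8 * a * p) + H ω := by
  set Z : ℕ → Ω → ℝ := fun j => innovationMaxSq η p (fun s => θ s - (j : ℤ)) a with hZ
  have hZm : ∀ j, Measurable (Z j) := fun j =>
    measurable_innovationMaxSq hη p (hθ.injective_sub j) a
  set Γ := ∑' j, ‖T j‖ₑ with hΓ
  have hx : ∀ j, Measurable fun ω => ‖Z j ω - ∫ ω, Z j ω ∂P‖ₑ := fun j =>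
    ((hZm j).sub_const _).enorm
  have hsm : Measurable fun ω => ∑' j : ℕ, ‖T j‖ₑ * ‖Z j ω - ∫ ω, Z j ω ∂P‖ₑ :=
    Measurable.tsum fun j => (hx j).const_mul _
  refine ⟨fun ω => Γ * ∑' j : ℕ, ‖T j‖ₑ * ‖Z j ω - ∫ ω, Z j ω ∂P‖ₑ, hsm.const_mul _, ?_,
    fun ω => ?_⟩
  · simp_rw [mul_pow]
    rw [lintegral_const_mul _ (hsm.pow_const 2), show Γ ^ 4 = Γ ^ 2 * Γ ^ 2 by ring, mul_assoc]
    gcongr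
    refine lintegral_sq_tsum_mul_le _ hx fun j => ?_
    have h2 := memLp_innovationMaxSq hη p (hθ.injective_sub j) a
    refine le_trans (le_of_eq ?_) (ENNReal.ofReal_le_ofReal
      (variance_innovationMaxSq_le hη p (hθ.injective_sub j) a))
    rw [h2.ofReal_variance_eq, evariance]
  · calc weightedMaxSq T η θ a ω
        ≤ Γ * ∑' j : ℕ, (‖T j‖ₑ * ENNReal.ofReal (8 * a * p) +
            ‖T j‖ₑ * ‖Z j ω - ∫ ω, Z j ω ∂P‖ₑ) := by
          unfold weightedMaxSq
          gcongr with j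
          rw [← mul_add]
          gcongr
          have h1 := integral_innovationMaxSq_le hη p (hθ.injective_sub j) a
          rw [Real.enorm_eq_ofReal_abs, ← ENNReal.ofReal_add (by positivity) (abs_nonneg _)]
          refine ENNReal.ofReal_le_ofReal ?_
          have := le_abs_self (Z j ω - ∫ ω, Z j ω ∂P)
          change Z j ω ≤ _
          linarith
      _ = _ := by
          rw [ENNReal.tsum_add, ENNReal.tsum_mul_right]
          ring

/-- The window may overlap the path, so its sum is not independent of the path innovations. After
expansion over pairs of lags, innovations off the lagged path give the martingale part `H`, those on
it the term `2 * weightedMaxSq`. -/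
theorem exists_majorant_inner_sum (hη : IsInnovationArray P η)
    (hs : ∀ᵐ ω ∂P, LinearSummable T η ω) {θ : ℕ → ℤ} (hθ : IsTimePath θ) (a : ℕ) (l h : ℤ) :
    ∃ H : Ω → ℝ≥0∞, Measurable H ∧
      ∫⁻ ω, H ω ^ 2 ∂P ≤ (∑' j, ‖T j‖ₑ) ^ 4 *
        ENNReal.ofReal (8 * a * ((Finset.Icc l h).card * p)) ∧
      ∀ᵐ ω ∂P, ∀ d ≤ a,
        ‖(inner ℝ (∑ t ∈ Finset.Icc l h, linearProcess T η t ω)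
          (∑ s ∈ Finset.range d, linearProcess T η (θ s) ω) : ℝ)‖ₑ ≤
        H ω + 2 * weightedMaxSq T η θ a ω := by
  classical
  set I : ℕ × ℕ → Finset ℤ := fun r => (Finset.Icc (l - r.1) (h - r.1)).filter
    (fun u => u ∉ (fun s => θ s - (r.2 : ℤ)) '' Set.Ico 0 a) with hI
  -- Both operators are gathered on the window side, so that bare innovations remain on the path
  -- side.
  set B : ℕ × ℕ → EuclideanSpace ℝ (Fin p) →L[ℝ] EuclideanSpace ℝ (Fin p) := fun r =>
    (normalizedOp (T r.2)).adjoint ∘L normalizedOp (T r.1) with hB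
  have hB1 : ∀ r, ‖B r‖ ≤ 1 := fun r => by
    refine (ContinuousLinearMap.opNorm_comp_le _ _).trans
      (mul_le_one₀ ?_ (norm_nonneg _) (norm_normalizedOp_le _))
    rw [LinearIsometryEquiv.norm_map]; exact norm_normalizedOp_le _
  set g : ℕ × ℕ → Ω → EuclideanSpace ℝ (Fin p) := fun r ω =>
    B r (∑ u ∈ I r, innovation η p u ω) with hg
  have hgm : ∀ r : ℕ × ℕ, Measurable[innovationSigma η
      {i | i.2 ∉ (fun s => θ s - (r.2 : ℤ)) '' Set.Ico 0 a}] (g r) := fun r =>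
    (B r).continuous.measurable.comp (@Finset.measurable_sum _ _ _ _ _ _ (innovationSigma η
      {i | i.2 ∉ (fun s => θ s - (r.2 : ℤ)) '' Set.Ico 0 a}) _ _ fun u hu =>
        measurable_innovation_sigma η p fun c => (Finset.mem_filter.1 hu).2)
  have hg2 : ∀ r, MemLp (g r) 2 P := fun r =>
    (B r).comp_memLp' (memLp_sum_innovation hη p (I r))
  have hgn : ∀ r, ∫ ω, ‖g r ω‖ ^ 2 ∂P ≤ (Finset.Icc l h).card * p := fun r => by
    refine (integral_norm_sq_map_le (hB1 r) (memLp_sum_innovation hη p (I r))).trans ?_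
    rw [integral_norm_sq_sum_innovation hη]
    have hIc : (I r).card ≤ (Finset.Icc (l - (r.1 : ℤ)) (h - r.1)).card :=
      Finset.card_le_card (by simp only [hI]; exact Finset.filter_subset _ _)
    have hcard : (I r).card ≤ (Finset.Icc l h).card := by
      refine hIc.trans ?_
      simp only [Int.card_Icc]
      omega
    exact mul_le_mul_of_nonneg_right (by exact_mod_cast hcard) (by positivity)
  set q : ℕ × ℕ → Ω → ℝ := fun r ω =>
    maxSq (fun s => inner ℝ (g r ω) (innovation η p (θ s - r.2) ω)) a with hq
  have key := fun r : ℕ × ℕ =>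
    lintegral_maxSq_inner_le hη (hθ.injective_sub r.2) a (hgm r) (hg2 r)
  have hw : ∑' r : ℕ × ℕ, ‖T r.1‖ₑ * ‖T r.2‖ₑ = (∑' j, ‖T j‖ₑ) ^ 2 := by
    rw [ENNReal.tsum_prod (f := fun i j => ‖T i‖ₑ * ‖T j‖ₑ), sq, ← ENNReal.tsum_mul_right]
    simp_rw [ENNReal.tsum_mul_left]
  refine ⟨fun ω => ∑' r : ℕ × ℕ, ‖T r.1‖ₑ * ‖T r.2‖ₑ * ENNReal.ofReal (Real.sqrt (q r ω)),
    Measurable.tsum fun r => ((key r).1.sqrt.ennreal_ofReal).const_mul _,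
    (lintegral_sq_tsum_mul_le _ (fun r => (key r).1.sqrt.ennreal_ofReal)
      (C := ENNReal.ofReal (8 * a * ((Finset.Icc l h).card * p))) fun r => ?_).trans_eq ?_, ?_⟩
  · refine (lintegral_congr fun ω => ofReal_sqrt_sq (maxSq_nonneg _ _)).trans_le ?_
    refine (key r).2.trans (ENNReal.ofReal_le_ofReal ?_)
    gcongr
    exact hgn r
  · rw [hw, ← pow_mul]
  · filter_upwards [hs] with ω hω d hd
    have hS := hasSum_sum_linearProcess (fun t => t) (Finset.Icc l h) hω
    have hW := hasSum_sum_linearProcess θ (Finset.range d) hω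
    set S := ∑ t ∈ Finset.Icc l h, linearProcess T η t ω
    set U : ℕ → EuclideanSpace ℝ (Fin p) := fun i =>
      ∑ t ∈ Finset.Icc l h, innovation η p (t - i) ω with hU
    set R : ℕ → EuclideanSpace ℝ (Fin p) := fun j =>
      ∑ s ∈ Finset.range d, innovation η p (θ s - j) ω with hR
    set Z : ℕ → ℝ≥0∞ := fun j =>
      ENNReal.ofReal (innovationMaxSq η p (fun s => θ s - (j : ℤ)) a ω) with hZ
    have hterm : ∀ i j : ℕ, ‖(inner ℝ (T i (U i)) (T j (R j)) : ℝ)‖ₑ ≤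
        ‖T i‖ₑ * ‖T j‖ₑ * ENNReal.ofReal (Real.sqrt (q (i, j) ω)) +
          ‖T i‖ₑ * ‖T j‖ₑ * (2 * Z j) := by
      intro i j
      rw [enorm_inner_eq, real_inner_comm, enorm_inner_eq, ← mul_assoc, mul_comm ‖T j‖ₑ, ← mul_add]
      gcongr
      obtain ⟨s₁, s₂, h1, h2, hsum⟩ := sum_innovation_eq_in_add_out (η := η) (p := p) hθ l h a i j
      have e : U i = _ := hsum ω
      set V := ∑ s ∈ Finset.range s₂, innovation η p (θ s - j) ω -
        ∑ s ∈ Finset.range s₁, innovation η p (θ s - j) ω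
      set Vo := ∑ u ∈ I (i, j), innovation η p u ω
      have e' : U i = V + Vo := e
      have hgij : g (i, j) ω = (normalizedOp (T j)).adjoint (normalizedOp (T i) Vo) := rfl
      rw [e', map_add, inner_add_right, add_comm]
      refine (enorm_add_le _ _).trans (add_le_add ?_ ?_)
      -- Off the path: the vector `g (i, j)` is independent of the path innovations.
      · refine enorm_le_ofReal_sqrt ?_
        rw [real_inner_comm, ← ContinuousLinearMap.adjoint_inner_left, ← hgij, inner_sum]
        exact sq_sum_range_le_maxSq
          (fun s => inner ℝ (g (i, j) ω) (innovation η p (θ s - j) ω)) hd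
      -- On the path: `‖R j‖² ≤ Z` and `‖V‖² ≤ 4 Z` bound the inner product by `2 Z`, with no
      -- independence used.
      · have hV := norm_sq_sub_sum_innovation_le (η := η) p (fun s => θ s - (j : ℤ)) h2 h1 ω
        have hRn := norm_sq_sum_innovation_le (η := η) p (fun s => θ s - (j : ℤ)) hd ω
        have hb1 := (normalizedOp (T j)).le_of_opNorm_le (norm_normalizedOp_le _) (R j)
        have hb2 := (normalizedOp (T i)).le_of_opNorm_le (norm_normalizedOp_le _) V
        rw [one_mul] at hb1 hb2
        have h2Z : 2 * Z j = ENNReal.ofReal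
            (2 * innovationMaxSq η p (fun s => θ s - (j : ℤ)) a ω) := by
          rw [ENNReal.ofReal_mul (by norm_num), ENNReal.ofReal_ofNat]
        rw [Real.enorm_eq_ofReal_abs, h2Z]
        refine ENNReal.ofReal_le_ofReal ?_
        refine (abs_real_inner_le_norm _ _).trans ((mul_le_mul hb1 hb2 (norm_nonneg _)
          (norm_nonneg _)).trans ?_)
        have hV' : ‖V‖ ^ 2 ≤ 4 * innovationMaxSq η p (fun s => θ s - (j : ℤ)) a ω := hV
        have hR' : ‖R j‖ ^ 2 ≤ innovationMaxSq η p (fun s => θ s - (j : ℤ)) a ω := hRn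
        nlinarith [sq_nonneg (2 * ‖R j‖ - ‖V‖)]
    calc _ ≤ ∑' j, ‖(inner ℝ S (T j (R j)) : ℝ)‖ₑ := enorm_inner_tsum_le S hW
      _ ≤ ∑' j, ∑' i, ‖(inner ℝ (T i (U i)) (T j (R j)) : ℝ)‖ₑ := by
          refine ENNReal.tsum_le_tsum fun j => ?_
          rw [real_inner_comm]
          refine (enorm_inner_tsum_le _ hS).trans_eq (tsum_congr fun i => ?_)
          rw [real_inner_comm]
      _ ≤ ∑' j, ∑' i, (‖T i‖ₑ * ‖T j‖ₑ * ENNReal.ofReal (Real.sqrt (q (i, j) ω)) +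
          ‖T i‖ₑ * ‖T j‖ₑ * (2 * Z j)) :=
          ENNReal.tsum_le_tsum fun j => ENNReal.tsum_le_tsum fun i => hterm i j
      _ = _ := by
          simp_rw [ENNReal.tsum_add]
          congr 1
          · rw [ENNReal.tsum_comm, ← ENNReal.tsum_prod
              (f := fun i j => ‖T i‖ₑ * ‖T j‖ₑ * ENNReal.ofReal (Real.sqrt (q (i, j) ω)))]
          · simp_rw [ENNReal.tsum_mul_right, weightedMaxSq]
            rw [← ENNReal.tsum_mul_left, ← ENNReal.tsum_mul_left]
            exact tsum_congr fun j => by ring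

end LinearProcess

/-! ### The least squares criterion near the true change point -/

section Criterion

variable {p : ℕ}

theorem sum_sub_mean_sq {ι : Type*} (s : Finset ι) (x : ι → ℝ) {r : ℝ} (hr : r = s.card)
    (h0 : r ≠ 0) :
    ∑ t ∈ s, (x t - 1 / r * ∑ t ∈ s, x t) ^ 2 = ∑ t ∈ s, x t ^ 2 - (∑ t ∈ s, x t) ^ 2 / r := by
  simp only [sub_sq, Finset.sum_add_distrib, Finset.sum_sub_distrib, ← Finset.sum_mul,
    ← Finset.mul_sum, Finset.sum_const, nsmul_eq_mul, ← hr]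
  field_simp
  ring

/-- The between-segment sum of squares for a split after time `m`. -/
noncomputable def splitScore (n : ℕ) (x : ℕ → EuclideanSpace ℝ (Fin p)) (m : ℕ) : ℝ :=
  ‖∑ t ∈ Finset.Icc 1 m, x t‖ ^ 2 / m + ‖∑ t ∈ Finset.Icc (m + 1) n, x t‖ ^ 2 / ((n : ℝ) - m)

theorem floor_mul_div {n : ℕ} (hn : 0 < n) (m : ℕ) : ⌊(n : ℝ) * ((m : ℝ) / n)⌋₊ = m := by
  rw [mul_div_cancel₀ _ (by exact_mod_cast hn.ne')]
  exact Nat.floor_natCast m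

theorem lsCriterion_eq {n m : ℕ} (hm : 0 < m) (hmn : m < n)
    (x : ℕ → EuclideanSpace ℝ (Fin p)) :
    lsCriterion n x ((m : ℝ) / n) =
      1 / (n : ℝ) * (∑ t ∈ Finset.Icc 1 n, ‖x t‖ ^ 2 - splitScore n x m) := by
  have hn : (n : ℝ) ≠ 0 := by exact_mod_cast (hm.trans hmn).ne'
  have hm' : (m : ℝ) ≠ 0 := by exact_mod_cast hm.ne'
  have hmn' : (n : ℝ) - m ≠ 0 := sub_ne_zero.2 (by exact_mod_cast hmn.ne')
  have e1 : (n : ℝ) * ((m : ℝ) / n) = m := by field_simp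
  have e2 : (n : ℝ) * (1 - (m : ℝ) / n) = n - m := by field_simp
  have hsplit : Finset.Icc 1 n = Finset.Icc 1 m ∪ Finset.Icc (m + 1) n := by
    ext; simp only [Finset.mem_Icc, Finset.mem_union]; omega
  have hdisj : Disjoint (Finset.Icc 1 m) (Finset.Icc (m + 1) n) := by
    rw [Finset.disjoint_left]; intro t; simp only [Finset.mem_Icc]; omega
  unfold lsCriterion meanBefore meanAfter
  rw [floor_mul_div (hm.trans hmn), e1, e2]
  congr 1
  simp_rw [sum_sub_mean_sq (Finset.Icc 1 m) (fun t => x t _) (r := m) (by simp) hm',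
    sum_sub_mean_sq (Finset.Icc (m + 1) n) (fun t => x t _) (r := (n : ℝ) - m)
      (by rw [Nat.card_Icc, Nat.cast_sub (by omega)]; push_cast; ring) hmn']
  rw [hsplit, Finset.sum_union hdisj, splitScore]
  simp_rw [EuclideanSpace.real_norm_sq_eq, Finset.sum_add_distrib, Finset.sum_sub_distrib,
    ← Finset.sum_div]
  rw [Finset.sum_comm (s := Finset.Icc 1 m), Finset.sum_comm (s := Finset.Icc (m + 1) n)]
  simp only [WithLp.ofLp_sum, Finset.sum_apply]
  ring

/-- Here `x`, `y` are the segment means and `e` is the deviation of the moved block from `d • x`.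
The change is exactly a drift and a cross term, both scaled by `l / (l + d)`, and a quadratic error.
-/
theorem splitScore_shift_eq {E : Type*} [NormedAddCommGroup E] [InnerProductSpace ℝ E]
    {k l d : ℝ} (hl : 0 < l) (hd : 0 < d) (hdk : d < k) (x y e : E) :
    ‖k • x - (d • x + e)‖ ^ 2 / (k - d) + ‖l • y + (d • x + e)‖ ^ 2 / (l + d) =
      ‖k • x‖ ^ 2 / k + ‖l • y‖ ^ 2 / l -
        l / (l + d) * (d * ‖x - y‖ ^ 2 + 2 * inner ℝ (x - y) e) +
        ‖e‖ ^ 2 * (1 / (k - d) + 1 / (l + d)) := by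
  have h1 : k - d ≠ 0 := by linarith
  have h2 : l + d ≠ 0 := by linarith
  have e1 : k • x - (d • x + e) = (k - d) • x - e := by rw [sub_smul]; abel
  rw [e1]
  simp only [← real_inner_self_eq_norm_sq, inner_add_left, inner_add_right, inner_sub_left,
    inner_sub_right, real_inner_smul_left, real_inner_smul_right]
  rw [real_inner_comm x e, real_inner_comm y e, real_inner_comm x y]
  field_simp
  ring

/-- The noise sums `S`, `S'` over the two regimes and `W` over a stretch of length `d` next to the
change point are small compared with the jump `v`. -/
structure NoiseSmall {E : Type*} [NormedAddCommGroup E] [InnerProductSpace ℝ E]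
    (κ N d : ℝ) (v S S' W : E) : Prop where
  left : ‖S‖ ≤ κ * (N * ‖v‖)
  right : ‖S'‖ ≤ κ * (N * ‖v‖)
  jump : |inner ℝ v W| ≤ κ * (d * ‖v‖ ^ 2)
  sq : ‖W‖ ^ 2 ≤ κ * (d * N * ‖v‖ ^ 2)
  inner_left : |inner ℝ S W| ≤ κ * (d * N * ‖v‖ ^ 2)
  inner_right : |inner ℝ S' W| ≤ κ * (d * N * ‖v‖ ^ 2)

theorem NoiseSmall.symm {E : Type*} [NormedAddCommGroup E] [InnerProductSpace ℝ E]
    {κ N d : ℝ} {u v S S' W : E} (h : NoiseSmall κ N d (u - v) S S' W) :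
    NoiseSmall κ N d (v - u) S' S W where
  left := by rw [norm_sub_rev]; exact h.right
  right := by rw [norm_sub_rev]; exact h.left
  jump := by rw [← neg_sub, inner_neg_left, abs_neg, norm_neg]; exact h.jump
  sq := by rw [norm_sub_rev]; exact h.sq
  inner_left := by rw [norm_sub_rev]; exact h.inner_right
  inner_right := by rw [norm_sub_rev]; exact h.inner_left

/-- With `δ = ‖μ₁ - μ₂‖`, the drift with its cross term costs at least `9/10 c d δ²`, the quadratic
error returns at most `6/100 c d δ²`; the tolerance `c ^ 2 / 100` is chosen for this gap. -/
theorem splitScore_shift_lt {E : Type*} [NormedAddCommGroup E] [InnerProductSpace ℝ E]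
    {c N k l d : ℝ} (hc : 0 < c) (hc' : c < 1 / 2) (hN : 0 < N) (hkl : k + l = N)
    (hk : c * N ≤ k) (hl : c * N ≤ l) (hd : 0 < d) (hdk : c * N ≤ k - d)
    {μ₁ μ₂ S S' W : E} (hv : μ₁ ≠ μ₂) (h : NoiseSmall (c ^ 2 / 100) N d (μ₁ - μ₂) S S' W) :
    ‖(k • μ₁ + S) - (d • μ₁ + W)‖ ^ 2 / (k - d) + ‖(l • μ₂ + S') + (d • μ₁ + W)‖ ^ 2 / (l + d) <
      ‖k • μ₁ + S‖ ^ 2 / k + ‖l • μ₂ + S'‖ ^ 2 / l := by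
  have hcN : 0 < c * N := by positivity
  have hk0 : 0 < k := by linarith
  have hl0 : 0 < l := by linarith
  have hdN : d ≤ N := by linarith
  set v := μ₁ - μ₂ with hvdef
  have hδ : 0 < ‖v‖ := norm_pos_iff.2 (sub_ne_zero.2 hv)
  set δ := ‖v‖ with hδdef
  set x := μ₁ + k⁻¹ • S with hx
  set y := μ₂ + l⁻¹ • S' with hy
  -- Passing to empirical means `x`, `y` forces this correction, since `d • μ₁ + W = d • x + e`.
  set e := W - (d / k) • S with he
  have e1 : k • μ₁ + S = k • x := by rw [hx, smul_add, smul_smul, mul_inv_cancel₀ hk0.ne', one_smul]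
  have e2 : l • μ₂ + S' = l • y := by rw [hy, smul_add, smul_smul, mul_inv_cancel₀ hl0.ne', one_smul]
  have e3 : d • μ₁ + W = d • x + e := by
    rw [hx, he, smul_add, smul_smul, div_eq_mul_inv]; abel
  rw [e1, e2, e3, splitScore_shift_eq hl0 hd (by linarith)]
  have hS : ‖S‖ / k ≤ c / 100 * δ := by
    rw [div_le_iff₀ hk0]
    calc _ ≤ _ := h.left
      _ = c / 100 * δ * (c * N) := by ring
      _ ≤ _ := by gcongr
  have hS' : ‖S'‖ / l ≤ c / 100 * δ := by
    rw [div_le_iff₀ hl0]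
    calc _ ≤ _ := h.right
      _ = c / 100 * δ * (c * N) := by ring
      _ ≤ _ := by gcongr
  have hcδ : c * δ ≤ δ / 2 := by nlinarith
  have hxy : x - y = v + (k⁻¹ • S - l⁻¹ • S') := by rw [hx, hy, hvdef]; abel
  have hdiff : ‖k⁻¹ • S - l⁻¹ • S'‖ ≤ δ / 100 := by
    refine (norm_sub_le _ _).trans ?_
    rw [norm_smul, norm_smul, norm_inv, norm_inv, Real.norm_of_nonneg hk0.le,
      Real.norm_of_nonneg hl0.le, inv_mul_eq_div, inv_mul_eq_div]
    linarith
  have hΔ1 : ‖x - y‖ ≤ 101 / 100 * δ := by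
    rw [hxy]; refine (norm_add_le _ _).trans ?_; linarith
  have hΔ2 : 99 / 100 * δ ≤ ‖x - y‖ := by
    have := norm_sub_le_norm_add v (k⁻¹ • S - l⁻¹ • S')
    rw [hxy]; linarith
  have hin : inner ℝ (x - y) e = inner ℝ v W + inner ℝ S W / k - inner ℝ S' W / l -
      d * (inner ℝ (x - y) S / k) := by
    have h1 : inner ℝ (x - y) W = inner ℝ v W + (inner ℝ S W / k - inner ℝ S' W / l) := by
      rw [hxy, inner_add_left v, inner_sub_left (k⁻¹ • S), real_inner_smul_left,
        real_inner_smul_left, inv_mul_eq_div, inv_mul_eq_div]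
    rw [he, inner_sub_right, real_inner_smul_right, h1]
    ring
  have hb : ∀ (Z : E) (r : ℝ), 0 < r → c * N ≤ r → |inner ℝ Z W| ≤ c ^ 2 / 100 * (d * N * δ ^ 2) →
      |inner ℝ Z W / r| ≤ d * δ ^ 2 / 200 := by
    intro Z r hr hcr hZ
    rw [abs_div, abs_of_pos hr, div_le_iff₀ hr]
    calc _ ≤ _ := hZ
      _ = c * (d * δ ^ 2 / 100) * (c * N) := by ring
      _ ≤ (1 / 2) * (d * δ ^ 2 / 100) * r := by gcongr
      _ = _ := by ring
  have hdδ : 0 < d * δ ^ 2 := by positivity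
  have hjump := h.jump
  have hsq := h.sq
  rw [← hδdef] at hjump hsq
  have b1 := (abs_le.1 hjump).1
  have b2 := (abs_le.1 (hb S k hk0 hk h.inner_left)).1
  have b3 := (abs_le.1 (hb S' l hl0 hl h.inner_right)).2
  have b4 : d * (inner ℝ (x - y) S / k) ≤ 101 / 20000 * (d * δ ^ 2) := by
    have h1 : inner ℝ (x - y) S / k ≤ ‖x - y‖ * (‖S‖ / k) := by
      rw [← mul_div_assoc]
      gcongr
      exact real_inner_le_norm _ _
    have h2 : ‖x - y‖ * (‖S‖ / k) ≤ 101 / 100 * δ * (δ / 200) :=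
      mul_le_mul hΔ1 (hS.trans (by linarith)) (by positivity) (by positivity)
    calc _ ≤ d * (101 / 100 * δ * (δ / 200)) := by gcongr; exact h1.trans h2
      _ = _ := by ring
  have hc2 : c ^ 2 / 100 * (d * δ ^ 2) ≤ d * δ ^ 2 / 400 := by
    have : c ^ 2 ≤ 1 / 4 := by nlinarith
    nlinarith
  have hlow : 9 / 10 * (d * δ ^ 2) ≤ d * ‖x - y‖ ^ 2 + 2 * inner ℝ (x - y) e := by
    have h1 : (99 / 100 * δ) ^ 2 ≤ ‖x - y‖ ^ 2 := by gcongr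
    have h2 : d * (99 / 100 * δ) ^ 2 ≤ d * ‖x - y‖ ^ 2 := by gcongr
    rw [hin]
    nlinarith
  have hfrac : c ≤ l / (l + d) := by
    rw [le_div_iff₀ (by linarith)]
    have : c * (l + d) ≤ c * N := by gcongr; linarith
    linarith
  have hmain : c * (9 / 10 * (d * δ ^ 2)) ≤
      l / (l + d) * (d * ‖x - y‖ ^ 2 + 2 * inner ℝ (x - y) e) := by gcongr
  have he2 : ‖e‖ ^ 2 ≤ 3 / 100 * (c ^ 2 * (d * N * δ ^ 2)) := by
    have h1 : ‖e‖ ≤ ‖W‖ + d * (‖S‖ / k) := by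
      refine (norm_sub_le _ _).trans_eq ?_
      rw [norm_smul, Real.norm_of_nonneg (by positivity)]
      ring
    have h2 : ‖e‖ ^ 2 ≤ (‖W‖ + d * (‖S‖ / k)) ^ 2 := by gcongr
    have h3 : (d * (‖S‖ / k)) ^ 2 ≤ (d * (c / 100 * δ)) ^ 2 := by gcongr
    have h4 : (d * (c / 100 * δ)) ^ 2 ≤ 1 / 10000 * (c ^ 2 * (d * N * δ ^ 2)) := by
      calc _ = 1 / 10000 * (c ^ 2 * (d * d * δ ^ 2)) := by ring
        _ ≤ _ := by gcongr
    have h6 : 0 < c ^ 2 * (d * N * δ ^ 2) := by positivity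
    have h7 : (‖W‖ + d * (‖S‖ / k)) ^ 2 ≤ 2 * ‖W‖ ^ 2 + 2 * (d * (‖S‖ / k)) ^ 2 := by
      linarith [sq_nonneg (‖W‖ - d * (‖S‖ / k)), add_sq ‖W‖ (d * (‖S‖ / k)),
        sub_sq ‖W‖ (d * (‖S‖ / k))]
    linarith
  have hinv : 1 / (k - d) + 1 / (l + d) ≤ 2 / (c * N) := by
    have h1 : 1 / (k - d) ≤ 1 / (c * N) := by gcongr
    have h2 : 1 / (l + d) ≤ 1 / (c * N) := by
      apply one_div_le_one_div_of_le hcN; linarith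
    calc _ ≤ 1 / (c * N) + 1 / (c * N) := add_le_add h1 h2
      _ = _ := by ring
  have hrhs : ‖e‖ ^ 2 * (1 / (k - d) + 1 / (l + d)) ≤ c * (6 / 100 * (d * δ ^ 2)) := by
    have : 0 < k - d := by linarith
    calc _ ≤ 3 / 100 * (c ^ 2 * (d * N * δ ^ 2)) * (2 / (c * N)) := by gcongr
      _ = _ := by field_simp; ring
  have : 0 < c * (d * δ ^ 2) := by positivity
  linarith

theorem sum_Icc_consecutive {E : Type*} [AddCommMonoid E] (f : ℕ → E) {a b m : ℕ} (h : a ≤ b + 1)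
    (h' : b ≤ m) :
    ∑ t ∈ Finset.Icc a m, f t = ∑ t ∈ Finset.Icc a b, f t + ∑ t ∈ Finset.Icc (b + 1) m, f t := by
  rw [← Finset.sum_union]
  · congr 1
    ext; simp only [Finset.mem_Icc, Finset.mem_union]; omega
  · rw [Finset.disjoint_left]; intro t; simp only [Finset.mem_Icc]; omega

theorem splitScore_lt_of_noiseSmall {c : ℝ} (hc : 0 < c) (hc' : c < 1 / 2) {n k m : ℕ}
    (hn : 0 < n) (hk : c * n ≤ k) (hk' : c * n ≤ n - k) (hm : c * n ≤ m) (hm' : c * n ≤ n - m)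
    {μ₁ μ₂ : EuclideanSpace ℝ (Fin p)} (hv : μ₁ ≠ μ₂) (e : ℕ → EuclideanSpace ℝ (Fin p))
    (hl : m < k → NoiseSmall (c ^ 2 / 100) n ((k : ℝ) - m) (μ₁ - μ₂)
      (∑ t ∈ Finset.Icc 1 k, e t) (∑ t ∈ Finset.Icc (k + 1) n, e t)
      (∑ t ∈ Finset.Icc (m + 1) k, e t))
    (hr : k < m → NoiseSmall (c ^ 2 / 100) n ((m : ℝ) - k) (μ₁ - μ₂)
      (∑ t ∈ Finset.Icc 1 k, e t) (∑ t ∈ Finset.Icc (k + 1) n, e t)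
      (∑ t ∈ Finset.Icc (k + 1) m, e t)) (hmk : m ≠ k) :
    splitScore n (fun t => (if t ≤ k then μ₁ else μ₂) + e t) m <
      splitScore n (fun t => (if t ≤ k then μ₁ else μ₂) + e t) k := by
  have hn' : (0 : ℝ) < n := by exact_mod_cast hn
  have hcn : 0 < c * (n : ℝ) := by positivity
  have hkn : k ≤ n := by
    have : (k : ℝ) ≤ n := by linarith
    exact_mod_cast this
  have hmn : m ≤ n := by
    have : (m : ℝ) ≤ n := by linarith
    exact_mod_cast this
  set x : ℕ → EuclideanSpace ℝ (Fin p) := fun t => (if t ≤ k then μ₁ else μ₂) + e t with hx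
  have hleft : ∀ a b : ℕ, a ≤ b → b ≤ k →
      ∑ t ∈ Finset.Icc (a + 1) b, x t = ((b : ℝ) - a) • μ₁ + ∑ t ∈ Finset.Icc (a + 1) b, e t := by
    intro a b hab hbk
    rw [hx, Finset.sum_add_distrib, Finset.sum_congr rfl fun t ht =>
      if_pos ((Finset.mem_Icc.1 ht).2.trans hbk), Finset.sum_const, Nat.card_Icc,
      ← Nat.cast_smul_eq_nsmul ℝ, Nat.add_sub_add_right, Nat.cast_sub hab]
  have hright : ∀ a b : ℕ, k ≤ a → a ≤ b →
      ∑ t ∈ Finset.Icc (a + 1) b, x t = ((b : ℝ) - a) • μ₂ + ∑ t ∈ Finset.Icc (a + 1) b, e t := by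
    intro a b hka hab
    rw [hx, Finset.sum_add_distrib, Finset.sum_congr rfl fun t ht =>
      if_neg (by have := (Finset.mem_Icc.1 ht).1; omega), Finset.sum_const, Nat.card_Icc,
      ← Nat.cast_smul_eq_nsmul ℝ, Nat.add_sub_add_right, Nat.cast_sub hab]
  have h1k := hleft 0 k (Nat.zero_le _) le_rfl
  have hkn' := hright k n le_rfl hkn
  simp only [Nat.cast_zero, sub_zero, zero_add] at h1k
  unfold splitScore
  rcases lt_or_gt_of_ne hmk with h | h
  · have hmk' : (m : ℝ) < k := by exact_mod_cast h
    have hW := hleft m k h.le le_rfl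
    have s1 := sum_Icc_consecutive x (a := 1) (b := m) (m := k) (by omega) h.le
    have s2 := sum_Icc_consecutive x (a := m + 1) (b := k) (m := n) (by omega) hkn
    have key := splitScore_shift_lt hc hc' hn' (k := k) (l := (n : ℝ) - k) (d := (k : ℝ) - m)
      (by ring) hk hk' (by linarith) (by linarith) hv (hl h)
    rw [← h1k, ← hkn', ← hW, s1, add_sub_cancel_right, add_comm (∑ t ∈ Finset.Icc (k + 1) n, x t),
      ← s2, ← s1] at key
    convert key using 3 <;> ring
  · have hmk' : (k : ℝ) < m := by exact_mod_cast h
    have hW := hright k m le_rfl h.le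
    have s1 := sum_Icc_consecutive x (a := 1) (b := k) (m := m) (by omega) h.le
    have s2 := sum_Icc_consecutive x (a := k + 1) (b := m) (m := n) (by omega) hmn
    -- Mirror image: the second regime now loses the block, so the roles of the regimes are
    -- exchanged.
    have key := splitScore_shift_lt hc hc' hn' (k := (n : ℝ) - k) (l := k) (d := (m : ℝ) - k)
      (by ring) hk' hk (by linarith) (by linarith) hv.symm (hr h).symm
    rw [← h1k, ← hkn', ← hW, s2, add_sub_cancel_left, ← s1, ← s2, add_comm,
      add_comm (_ / ((n : ℝ) - k))] at key
    convert key using 3 <;> ring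

end Criterion

/-! ### Tail bounds -/

theorem measure_ofReal_le_le {Ω : Type*} [MeasurableSpace Ω] {P : Measure Ω} {H : Ω → ℝ≥0∞}
    (hH : Measurable H) {B b t : ℝ} (ht : 0 < t) (hB : ∫⁻ ω, H ω ^ 2 ∂P ≤ ENNReal.ofReal B)
    (hb : B ≤ b * t ^ 2) : P {ω | ENNReal.ofReal t ≤ H ω} ≤ ENNReal.ofReal b := by
  have ht2 : ENNReal.ofReal (t ^ 2) ≠ 0 := by simpa using by positivity
  calc P {ω | ENNReal.ofReal t ≤ H ω} ≤ P {ω | ENNReal.ofReal (t ^ 2) ≤ H ω ^ 2} := by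
        refine measure_mono fun ω (hω : ENNReal.ofReal t ≤ H ω) => ?_
        change ENNReal.ofReal (t ^ 2) ≤ H ω ^ 2
        rw [ENNReal.ofReal_pow ht.le]
        gcongr
    _ ≤ (∫⁻ ω, H ω ^ 2 ∂P) / ENNReal.ofReal (t ^ 2) :=
        meas_ge_le_lintegral_div (hH.pow_const 2).aemeasurable ht2 ENNReal.ofReal_ne_top
    _ ≤ ENNReal.ofReal B / ENNReal.ofReal (t ^ 2) := by gcongr
    _ = ENNReal.ofReal (B / t ^ 2) := (ENNReal.ofReal_div_of_pos (by positivity)).symm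
    _ ≤ _ := ENNReal.ofReal_le_ofReal ((div_le_iff₀ (by positivity)).2 hb)

theorem norm_le_of_enorm_le_of_lt {E : Type*} [NormedAddCommGroup E] {x : E} {t : ℝ} {H : ℝ≥0∞}
    (ht : 0 ≤ t) (h : ‖x‖ₑ ≤ H) (hH : H < ENNReal.ofReal t) : ‖x‖ ≤ t := by
  rw [← ENNReal.ofReal_le_ofReal_iff ht, ofReal_norm]
  exact h.trans hH.le

section LinearProcess

variable {Ω : Type*} {p : ℕ}
  {T : ℕ → EuclideanSpace ℝ (Fin p) →L[ℝ] EuclideanSpace ℝ (Fin p)} {η : ℕ → ℤ → Ω → ℝ}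

theorem tsum_enorm_eq_ofReal (hT : Summable fun j => ‖T j‖) :
    ∑' j, ‖T j‖ₑ = ENNReal.ofReal (∑' j, ‖T j‖) := by
  rw [ENNReal.ofReal_tsum_of_nonneg (fun _ => norm_nonneg _) hT]
  exact tsum_congr fun j => (ofReal_norm _).symm

/-- Some stretch of the path `θ` of length between `y` and `2 y` violates the noise bounds. -/
def blockViolation (T : ℕ → EuclideanSpace ℝ (Fin p) →L[ℝ] EuclideanSpace ℝ (Fin p))
    (η : ℕ → ℤ → Ω → ℝ) (κ N y : ℝ) (v : EuclideanSpace ℝ (Fin p)) (k n : ℕ) (θ : ℕ → ℤ) :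
    Set Ω :=
  {ω | ∃ d : ℕ, y ≤ d ∧ d ≤ 2 * y ∧
    ¬ (|inner ℝ v (∑ s ∈ Finset.range d, linearProcess T η (θ s) ω)| ≤ κ * (d * ‖v‖ ^ 2) ∧
      ‖∑ s ∈ Finset.range d, linearProcess T η (θ s) ω‖ ^ 2 ≤ κ * (d * N * ‖v‖ ^ 2) ∧
      |inner ℝ (∑ t ∈ Finset.Icc (1 : ℤ) k, linearProcess T η t ω)
        (∑ s ∈ Finset.range d, linearProcess T η (θ s) ω)| ≤ κ * (d * N * ‖v‖ ^ 2) ∧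
      |inner ℝ (∑ t ∈ Finset.Icc (k + 1 : ℤ) n, linearProcess T η t ω)
        (∑ s ∈ Finset.range d, linearProcess T η (θ s) ω)| ≤ κ * (d * N * ‖v‖ ^ 2))}

variable [MeasurableSpace Ω] {P : Measure Ω} [IsProbabilityMeasure P]

theorem measure_norm_sum_gt_le (hη : IsInnovationArray P η)
    (hs : ∀ᵐ ω ∂P, LinearSummable T η ω) (hT : Summable fun j => ‖T j‖) {κ δ : ℝ} (hκ : 0 < κ)
    (hδ : 0 < δ) {n : ℕ} (hn : 0 < n) {l h : ℤ} (hc : (Finset.Icc l h).card ≤ n) :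
    P {ω | ¬ ‖∑ t ∈ Finset.Icc l h, linearProcess T η t ω‖ ≤ κ * (n * δ)} ≤
      ENNReal.ofReal ((∑' j, ‖T j‖) ^ 2 * p / (κ ^ 2 * (n * δ ^ 2))) := by
  obtain ⟨H, hHm, hH, hle⟩ := exists_majorant_norm_sum hη hs l h
  have hn' : (0 : ℝ) < n := by exact_mod_cast hn
  have hc' : ((Finset.Icc l h).card : ℝ) ≤ n := by exact_mod_cast hc
  have hγ : 0 ≤ ∑' j, ‖T j‖ := tsum_nonneg fun _ => norm_nonneg _
  have ht : 0 < κ * (n * δ) := by positivity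
  rw [tsum_enorm_eq_ofReal hT, ← ENNReal.ofReal_pow hγ, ← ENNReal.ofReal_mul (by positivity)] at hH
  refine (measure_mono_ae ?_).trans (measure_ofReal_le_le hHm ht hH ?_)
  · filter_upwards [hle] with ω hω (hbad : ¬ _)
    by_contra hlt
    exact hbad (norm_le_of_enorm_le_of_lt ht.le hω (not_le.1 hlt))
  · calc _ ≤ (∑' j, ‖T j‖) ^ 2 * (n * p) := by gcongr
      _ = _ := by field_simp

/-- The first term collects `16 + 64 + 64` from the jump and the two regime cross terms and decays
in `y`. The second comes from the fluctuation of the squared norm and is the same for all blocks. -/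
theorem measure_blockViolation_le (hη : IsInnovationArray P η)
    (hs : ∀ᵐ ω ∂P, LinearSummable T η ω) (hT : Summable fun j => ‖T j‖) {κ y : ℝ} (hκ : 0 < κ)
    (hκ' : κ ≤ 1) (hy : 0 < y) {v : EuclideanSpace ℝ (Fin p)} (hv : v ≠ 0) {k n : ℕ} (hn : 0 < n)
    (hkn : k ≤ n) {θ : ℕ → ℤ} (hθ : IsTimePath θ)
    (hr : 128 * ((∑' j, ‖T j‖) ^ 2 * p) ≤ κ * (n * ‖v‖ ^ 2)) :
    P (blockViolation T η κ n y v k n θ) ≤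
      ENNReal.ofReal (144 * (∑' j, ‖T j‖) ^ 2 / (κ ^ 2 * (y * ‖v‖ ^ 2)) +
        256 * (88 + 66 * ∫ ω, η 0 0 ω ^ 4 ∂P) * (∑' j, ‖T j‖) ^ 4 * p /
          (κ ^ 2 * (n ^ 2 * ‖v‖ ^ 4))) := by
  set a := ⌊2 * y⌋₊ with ha
  have hδ : 0 < ‖v‖ := norm_pos_iff.2 hv
  have hn' : (0 : ℝ) < n := by exact_mod_cast hn
  have hγ : 0 ≤ ∑' j, ‖T j‖ := tsum_nonneg fun _ => norm_nonneg _
  have ha' : (a : ℝ) ≤ 2 * y := Nat.floor_le (by positivity)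
  have hK : 0 ≤ ∫ ω, η 0 0 ω ^ 4 ∂P := integral_nonneg fun ω => by positivity
  obtain ⟨H2, hm2, hi2, hle2⟩ := exists_majorant_inner_const hη hs hθ a v
  obtain ⟨H3, hm3, hi3, hle3⟩ := exists_majorant_weightedMaxSq (T := T) hη hθ a
  obtain ⟨H4, hm4, hi4, hle4⟩ := exists_majorant_inner_sum hη hs hθ a 1 k
  obtain ⟨H5, hm5, hi5, hle5⟩ := exists_majorant_inner_sum hη hs hθ a (k + 1) n
  rw [tsum_enorm_eq_ofReal hT, ← ENNReal.ofReal_pow hγ, ← ENNReal.ofReal_mul (by positivity)]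
    at hi2 hi3 hi4 hi5
  rw [tsum_enorm_eq_ofReal hT, ← ENNReal.ofReal_pow hγ, ← ENNReal.ofReal_mul (by positivity)]
    at hle3
  set γ := ∑' j, ‖T j‖ with hγdef
  set δ := ‖v‖ with hδdef
  set C := 88 + 66 * ∫ ω, η 0 0 ω ^ 4 ∂P with hC
  have hC0 : 0 ≤ C := by positivity
  have hcard1 : ((Finset.Icc (1 : ℤ) k).card : ℝ) ≤ n := by
    rw [Int.card_Icc]
    have : ((k : ℤ) + 1 - 1).toNat ≤ n := by omega
    exact_mod_cast this
  have hcard2 : ((Finset.Icc (k + 1 : ℤ) n).card : ℝ) ≤ n := by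
    rw [Int.card_Icc]
    have : ((n : ℤ) + 1 - (k + 1)).toNat ≤ n := by omega
    exact_mod_cast this
  have hγn : γ ^ 2 * p ≤ n * δ ^ 2 := by
    have : 0 ≤ γ ^ 2 * p := by positivity
    have : κ * (n * δ ^ 2) ≤ 1 * (n * δ ^ 2) := by gcongr
    linarith
  have p2 : P {ω | ENNReal.ofReal (κ * (y * δ ^ 2)) ≤ H2 ω} ≤
      ENNReal.ofReal (16 * γ ^ 2 / (κ ^ 2 * (y * δ ^ 2))) := by
    refine measure_ofReal_le_le hm2 (by positivity) hi2 ?_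
    calc _ ≤ γ ^ 2 * (8 * (2 * y) * δ ^ 2) := by gcongr
      _ = _ := by field_simp; ring
  have p3 : P {ω | ENNReal.ofReal (κ * (y * n * δ ^ 2) / 8) ≤ H3 ω} ≤
      ENNReal.ofReal (256 * C * γ ^ 4 * p / (κ ^ 2 * (n ^ 2 * δ ^ 4))) := by
    refine measure_ofReal_le_le hm3 (by positivity) hi3 ?_
    calc _ ≤ γ ^ 4 * (p * (C * (2 * y) ^ 2)) := by gcongr
      _ = _ := by field_simp; ring
  have p45 : ∀ (H : Ω → ℝ≥0∞), Measurable H → ∀ r : ℝ, 0 ≤ r → r ≤ n →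
      ∫⁻ ω, H ω ^ 2 ∂P ≤ ENNReal.ofReal (γ ^ 4 * (8 * a * (r * p))) →
      P {ω | ENNReal.ofReal (κ * (y * n * δ ^ 2) / 2) ≤ H ω} ≤
        ENNReal.ofReal (64 * γ ^ 2 / (κ ^ 2 * (y * δ ^ 2))) := by
    intro H hm r hr0 hrn hi
    refine measure_ofReal_le_le hm (by positivity) hi ?_
    calc _ ≤ γ ^ 4 * (8 * (2 * y) * (n * p)) := by gcongr
      _ = 16 * γ ^ 2 * y * n * (γ ^ 2 * p) := by ring
      _ ≤ 16 * γ ^ 2 * y * n * (n * δ ^ 2) := by gcongr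
      _ = _ := by field_simp; ring
  have p4 := p45 H4 hm4 _ (Nat.cast_nonneg _) hcard1 hi4
  have p5 := p45 H5 hm5 _ (Nat.cast_nonneg _) hcard2 hi5
  have hsub : blockViolation T η κ n y v k n θ ≤ᵐ[P]
      (({ω | ENNReal.ofReal (κ * (y * δ ^ 2)) ≤ H2 ω} ∪
        {ω | ENNReal.ofReal (κ * (y * n * δ ^ 2) / 8) ≤ H3 ω}) ∪
        ({ω | ENNReal.ofReal (κ * (y * n * δ ^ 2) / 2) ≤ H4 ω} ∪
        {ω | ENNReal.ofReal (κ * (y * n * δ ^ 2) / 2) ≤ H5 ω}) : Set Ω) := by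
    filter_upwards [hs, hle2, hle4, hle5] with ω hω h2 h4 h5 hbad
    by_contra hgood
    have hgood' : (¬ ENNReal.ofReal (κ * (y * δ ^ 2)) ≤ H2 ω ∧
        ¬ ENNReal.ofReal (κ * (y * n * δ ^ 2) / 8) ≤ H3 ω) ∧
        (¬ ENNReal.ofReal (κ * (y * n * δ ^ 2) / 2) ≤ H4 ω ∧
        ¬ ENNReal.ofReal (κ * (y * n * δ ^ 2) / 2) ≤ H5 ω) := by
      refine ⟨⟨fun h => hgood ?_, fun h => hgood ?_⟩, fun h => hgood ?_, fun h => hgood ?_⟩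
      · exact Or.inl (Or.inl h)
      · exact Or.inl (Or.inr h)
      · exact Or.inr (Or.inl h)
      · exact Or.inr (Or.inr h)
    obtain ⟨⟨g2, g3⟩, g4, g5⟩ := hgood'
    rw [not_le] at g2 g3 g4 g5
    obtain ⟨d, hyd, hdy, hviol⟩ := hbad
    have hda : d ≤ a := Nat.le_floor hdy
    have hG : weightedMaxSq T η θ a ω < ENNReal.ofReal (κ * (y * n * δ ^ 2) / 4) := by
      refine (hle3 ω).trans_lt ?_
      have hsplit : κ * (y * n * δ ^ 2) / 4 =
          κ * (y * n * δ ^ 2) / 8 + κ * (y * n * δ ^ 2) / 8 := by ring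
      rw [hsplit, ENNReal.ofReal_add (by positivity) (by positivity)]
      refine ENNReal.add_lt_add_of_le_of_lt ENNReal.ofReal_ne_top
        (ENNReal.ofReal_le_ofReal ?_) g3
      -- The factor `128` in `hr` is what brings this mean below one eighth of the threshold.
      calc γ ^ 2 * (8 * a * p) ≤ γ ^ 2 * (8 * (2 * y) * p) := by gcongr
        _ = y / 8 * (128 * (γ ^ 2 * p)) := by ring
        _ ≤ y / 8 * (κ * (n * δ ^ 2)) := by gcongr
        _ = _ := by ring
    have h2G : 2 * weightedMaxSq T η θ a ω ≤ ENNReal.ofReal (κ * (y * n * δ ^ 2) / 2) := by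
      calc _ ≤ 2 * ENNReal.ofReal (κ * (y * n * δ ^ 2) / 4) := by gcongr
        _ = ENNReal.ofReal (2 * (κ * (y * n * δ ^ 2) / 4)) := by
          rw [ENNReal.ofReal_mul (by norm_num), ENNReal.ofReal_ofNat]
        _ = _ := by congr 1; ring
    have hcross : ∀ (Z : ℝ) (H : ℝ≥0∞), H < ENNReal.ofReal (κ * (y * n * δ ^ 2) / 2) →
        ‖Z‖ₑ ≤ H + 2 * weightedMaxSq T η θ a ω → |Z| ≤ κ * (d * n * δ ^ 2) := by
      intro Z H hH hZ
      refine (norm_le_of_enorm_le_of_lt (t := κ * (y * n * δ ^ 2)) (by positivity) hZ ?_).trans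
        (by gcongr)
      have hsplit : κ * (y * n * δ ^ 2) =
          κ * (y * n * δ ^ 2) / 2 + κ * (y * n * δ ^ 2) / 2 := by ring
      rw [hsplit, ENNReal.ofReal_add (by positivity) (by positivity)]
      exact ENNReal.add_lt_add_of_lt_of_le (h2G.trans_lt ENNReal.ofReal_lt_top).ne hH h2G
    refine hviol ⟨?_, ?_, hcross _ _ g4 (h4 d hda), hcross _ _ g5 (h5 d hda)⟩
    · exact (norm_le_of_enorm_le_of_lt (by positivity) (h2 d hda) g2).trans (by gcongr)
    · have hW := enorm_sq_sum_linearProcess_le θ hda hω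
      rw [← ofReal_norm, ← ENNReal.ofReal_pow (norm_nonneg _)] at hW
      have := (ENNReal.ofReal_le_ofReal_iff (by positivity)).1 (hW.trans hG.le)
      refine this.trans ?_
      calc κ * (y * n * δ ^ 2) / 4 ≤ κ * (y * n * δ ^ 2) := by
            have : 0 < κ * (y * n * δ ^ 2) := by positivity
            linarith
        _ ≤ _ := by gcongr
  calc _ ≤ _ := measure_mono_ae hsub
    _ ≤ _ := (measure_union_le _ _).trans (add_le_add (measure_union_le _ _)
        (measure_union_le _ _))
    _ ≤ _ := add_le_add (add_le_add p2 p3) (add_le_add p4 p5)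
    _ = _ := by
        rw [← ENNReal.ofReal_add (by positivity) (by positivity),
          ← ENNReal.ofReal_add (by positivity) (by positivity),
          ← ENNReal.ofReal_add (by positivity) (by positivity)]
        congr 1
        ring

/-- The union of the violations over dyadic blocks. -/
theorem measure_iUnion_blockViolation_le (hη : IsInnovationArray P η)
    (hs : ∀ᵐ ω ∂P, LinearSummable T η ω) (hT : Summable fun j => ‖T j‖) {κ M : ℝ} (hκ : 0 < κ)
    (hκ' : κ ≤ 1) (hM : 1 ≤ M) {v : EuclideanSpace ℝ (Fin p)} (hv : v ≠ 0)
    (hγ : 0 < ∑' j, ‖T j‖) {k n : ℕ} (hn : 0 < n)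
    (hkn : k ≤ n) {θ : ℕ → ℤ} (hθ : IsTimePath θ)
    (hr : 128 * ((∑' j, ‖T j‖) ^ 2 * p) ≤ κ * (n * ‖v‖ ^ 2)) :
    P (⋃ i ∈ Finset.range ⌊n * ‖v‖ ^ 2 / (∑' j, ‖T j‖) ^ 2⌋₊,
        blockViolation T η κ n (M * ((∑' j, ‖T j‖) ^ 2 / ‖v‖ ^ 2) * 2 ^ i) v k n θ) ≤
      ENNReal.ofReal (288 / (κ ^ 2 * M) + 256 * (88 + 66 * ∫ ω, η 0 0 ω ^ 4 ∂P) *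
        ((∑' j, ‖T j‖) ^ 2 * p / (n * ‖v‖ ^ 2)) / κ ^ 2) := by
  have hδ : 0 < ‖v‖ := norm_pos_iff.2 hv
  have hn' : (0 : ℝ) < n := by exact_mod_cast hn
  have hK : 0 ≤ ∫ ω, η 0 0 ω ^ 4 ∂P := integral_nonneg fun ω => by positivity
  set γ := ∑' j, ‖T j‖ with hγdef
  set δ := ‖v‖ with hδdef
  set C := 88 + 66 * ∫ ω, η 0 0 ω ^ 4 ∂P with hC
  have hC0 : 0 ≤ C := by positivity
  have hM0 : 0 < M := by linarith
  set N := ⌊n * δ ^ 2 / γ ^ 2⌋₊ with hN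
  have hN' : (N : ℝ) ≤ n * δ ^ 2 / γ ^ 2 := Nat.floor_le (by positivity)
  refine (measure_biUnion_finset_le _ _).trans ((Finset.sum_le_sum fun i _ =>
    measure_blockViolation_le hη hs hT hκ hκ' (by positivity) hv hn hkn hθ hr).trans ?_)
  rw [← ENNReal.ofReal_sum_of_nonneg fun i _ => by positivity]
  refine ENNReal.ofReal_le_ofReal ?_
  rw [Finset.sum_add_distrib, Finset.sum_const, Finset.card_range, nsmul_eq_mul]
  have hgeom : ∑ i ∈ Finset.range N, ((1 : ℝ) / 2) ^ i ≤ 2 := by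
    rw [geom_sum_eq (by norm_num)]
    have : (0 : ℝ) < (1 / 2) ^ N := by positivity
    rw [div_le_iff_of_neg (by norm_num)]
    linarith
  refine add_le_add ?_ ?_
  · calc _ = ∑ i ∈ Finset.range N, 144 / (κ ^ 2 * M) * ((1 : ℝ) / 2) ^ i := by
          refine Finset.sum_congr rfl fun i _ => ?_
          rw [one_div, inv_pow]
          simp only [← hγdef, ← hδdef]
          field_simp
      _ ≤ 144 / (κ ^ 2 * M) * 2 := by
          rw [← Finset.mul_sum]; gcongr
      _ = _ := by ring
  -- The bound does not depend on the block, so it is multiplied by the number of blocks; that crude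
  -- count already suffices under (SNR).
  · calc _ ≤ (n * δ ^ 2 / γ ^ 2) * (256 * C * γ ^ 4 * p / (κ ^ 2 * (n ^ 2 * δ ^ 4))) := by gcongr
      _ = _ := by field_simp

/-! ### Time segments as paths, and the finite sample bound -/

theorem sum_Icc_natCast {E : Type*} [AddCommMonoid E] (f : ℤ → E) (a b : ℕ) :
    ∑ t ∈ Finset.Icc a b, f t = ∑ t ∈ Finset.Icc (a : ℤ) b, f t := by
  refine Finset.sum_bij (fun t _ => (t : ℤ)) ?_ ?_ ?_ fun _ _ => rfl
  · intro t ht; simp only [Finset.mem_Icc] at ht ⊢; omega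
  · intro t _ t' _ h; exact_mod_cast h
  · intro t ht
    simp only [Finset.mem_Icc] at ht
    exact ⟨t.toNat, by simp only [Finset.mem_Icc]; omega, by omega⟩

theorem sum_Icc_eq_sum_range_add {E : Type*} [AddCommMonoid E] (f : ℤ → E) {k m : ℕ} (h : k ≤ m) :
    ∑ t ∈ Finset.Icc (k + 1) m, f t = ∑ s ∈ Finset.range (m - k), f ((k + 1 : ℤ) + s) := by
  refine (Finset.sum_bij (fun s _ => k + 1 + s) ?_ ?_ ?_ fun _ _ => by push_cast; rfl).symm
  · intro t ht; simp only [Finset.mem_Icc, Finset.mem_range] at ht ⊢; omega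
  · intro t _ t' _ h; omega
  · intro t ht
    simp only [Finset.mem_Icc] at ht
    exact ⟨t - (k + 1), by simp only [Finset.mem_range]; omega, by omega⟩

theorem sum_Icc_eq_sum_range_sub {E : Type*} [AddCommMonoid E] (f : ℤ → E) {k m : ℕ} (h : m ≤ k) :
    ∑ t ∈ Finset.Icc (m + 1) k, f t = ∑ s ∈ Finset.range (k - m), f ((k : ℤ) - s) := by
  refine (Finset.sum_bij (fun s _ => k - s) ?_ ?_ ?_ fun s hs => ?_).symm
  · intro t ht; simp only [Finset.mem_Icc, Finset.mem_range] at ht ⊢; omega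
  · intro t ht t' ht' h; simp only [Finset.mem_range] at ht ht'; omega
  · intro t ht
    simp only [Finset.mem_Icc] at ht
    exact ⟨k - t, by simp only [Finset.mem_range]; omega, by omega⟩
  · rw [Nat.cast_sub (by simp only [Finset.mem_range] at hs; omega)]

/-- A finite sample tail bound for the least squares estimate. -/
theorem measure_estimate_far_le (hη : IsInnovationArray P η)
    (hs : ∀ᵐ ω ∂P, LinearSummable T η ω) (hT : Summable fun j => ‖T j‖)
    {c M : ℝ} (hc : 0 < c) (hc' : c < 1 / 2) (hM : 1 ≤ M)
    {μ₁ μ₂ : EuclideanSpace ℝ (Fin p)} (hμ : μ₁ ≠ μ₂) (hγ : 0 < ∑' j, ‖T j‖)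
    {n : ℕ} (hn : 0 < n) {τ : ℝ} (hτ : τ ∈ candidates n c)
    (hr : 128 * ((∑' j, ‖T j‖) ^ 2 * p) ≤ c ^ 2 / 100 * (n * ‖μ₁ - μ₂‖ ^ 2))
    {τhat : Ω → ℝ} (hτhat : ∀ᵐ ω ∂P, IsLeastSquaresEstimate n c
      (fun t : ℕ => (if t ≤ ⌊(n : ℝ) * τ⌋₊ then μ₁ else μ₂) + linearProcess T η t ω) (τhat ω)) :
    P {ω | M < |(n : ℝ) * ((∑' j, ‖T j‖) ^ 2)⁻¹ * ‖μ₁ - μ₂‖ ^ 2 * (τhat ω - τ)|} ≤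
      ENNReal.ofReal (576 / ((c ^ 2 / 100) ^ 2 * M) +
        (2 + 512 * (88 + 66 * ∫ ω, η 0 0 ω ^ 4 ∂P)) *
          ((∑' j, ‖T j‖) ^ 2 * p / (n * ‖μ₁ - μ₂‖ ^ 2)) / (c ^ 2 / 100) ^ 2) := by
  have hn' : (0 : ℝ) < n := by exact_mod_cast hn
  have hv : μ₁ - μ₂ ≠ 0 := sub_ne_zero.2 hμ
  have hδ : 0 < ‖μ₁ - μ₂‖ := norm_pos_iff.2 hv
  have hK : 0 ≤ ∫ ω, η 0 0 ω ^ 4 ∂P := integral_nonneg fun ω => by positivity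
  obtain ⟨⟨k, rfl⟩, hτ1, hτ2⟩ := hτ
  have hmem : ∀ m : ℕ, (m : ℝ) / n ∈ candidates n c → c * n < m ∧ c * n < n - m := by
    rintro m ⟨-, h1, h2⟩
    rw [lt_div_iff₀ hn'] at h1
    rw [div_lt_iff₀ hn'] at h2
    constructor <;> linarith
  have hkc : (k : ℝ) / n ∈ candidates n c := ⟨⟨k, rfl⟩, hτ1, hτ2⟩
  obtain ⟨hk1, hk2⟩ := hmem k hkc
  have hcn : 0 < c * (n : ℝ) := by positivity
  have hkn : k ≤ n := by
    have : (k : ℝ) ≤ n := by linarith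
    exact_mod_cast this
  rw [floor_mul_div hn] at hτhat
  set κ := c ^ 2 / 100 with hκdef
  have hκ : 0 < κ := by positivity
  have hκ' : κ ≤ 1 := by rw [hκdef]; nlinarith
  have hcard1 : (Finset.Icc (1 : ℤ) k).card ≤ n := by rw [Int.card_Icc]; omega
  have hcard2 : (Finset.Icc (k + 1 : ℤ) n).card ≤ n := by rw [Int.card_Icc]; omega
  have q1 := measure_norm_sum_gt_le hη hs hT hκ hδ hn hcard1
  have q2 := measure_norm_sum_gt_le hη hs hT hκ hδ hn hcard2
  have q3 := measure_iUnion_blockViolation_le hη hs hT hκ hκ' hM hv hγ hn hkn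
    (isTimePath_sub (k : ℤ)) hr
  have q4 := measure_iUnion_blockViolation_le hη hs hT hκ hκ' hM hv hγ hn hkn
    (isTimePath_add (k + 1 : ℤ)) hr
  set γ := ∑' j, ‖T j‖ with hγdef
  set δ := ‖μ₁ - μ₂‖ with hδdef
  set x := γ ^ 2 / δ ^ 2 with hx
  have hx0 : 0 < x := by positivity
  have hM0 : 0 < M := by linarith
  have hblock : ∀ d : ℝ, d ≤ n → M * x < d → ∃ i ∈ Finset.range ⌊n * δ ^ 2 / γ ^ 2⌋₊,
      M * x * 2 ^ i ≤ d ∧ d ≤ 2 * (M * x * 2 ^ i) := by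
    intro d hdn hd
    obtain ⟨i, hi1, hi2⟩ := exists_nat_pow_near (x := d / (M * x)) (y := 2)
      ((one_le_div (by positivity)).2 hd.le) (by norm_num)
    rw [le_div_iff₀ (by positivity)] at hi1
    rw [div_lt_iff₀ (by positivity), pow_succ] at hi2
    -- The index obeys `i < 2 ^ i ≤ n / x`, far more room than the logarithmic number of blocks
    -- needed.
    refine ⟨i, Finset.mem_range.2 (i.lt_two_pow_self.trans_le (Nat.le_floor ?_)), by linarith,
      by linarith⟩
    have e : n * δ ^ 2 / γ ^ 2 = n / x := by rw [hx]; field_simp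
    rw [e, le_div_iff₀ hx0]
    push_cast
    have : 2 ^ i * (1 * x) ≤ 2 ^ i * (M * x) := by gcongr
    linarith
  refine (measure_mono_ae (t := (({ω | ¬ ‖∑ t ∈ Finset.Icc (1 : ℤ) k, linearProcess T η t ω‖ ≤
      κ * (n * δ)} ∪ {ω | ¬ ‖∑ t ∈ Finset.Icc (k + 1 : ℤ) n, linearProcess T η t ω‖ ≤
      κ * (n * δ)}) ∪ ((⋃ i ∈ Finset.range ⌊n * δ ^ 2 / γ ^ 2⌋₊,
        blockViolation T η κ n (M * x * 2 ^ i) (μ₁ - μ₂) k n fun s => (k : ℤ) - s) ∪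
      (⋃ i ∈ Finset.range ⌊n * δ ^ 2 / γ ^ 2⌋₊,
        blockViolation T η κ n (M * x * 2 ^ i) (μ₁ - μ₂) k n fun s => (k + 1 : ℤ) + s)) :
      Set Ω)) ?_).trans ?_
  · filter_upwards [hτhat] with ω hω (hfar : M < _)
    obtain ⟨⟨⟨m, hm⟩, hm1, hm2⟩, hmin⟩ := hω
    rw [hm] at hfar hm1 hm2 hmin
    by_contra hgood
    change ω ∉ ((_ ∪ _) ∪ (_ ∪ _) : Set Ω) at hgood
    simp only [Set.mem_union, Set.mem_iUnion, not_or, not_exists, Set.mem_ofPred_eq,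
      not_not] at hgood
    obtain ⟨⟨g1, g2⟩, g3, g4⟩ := hgood
    obtain ⟨hmc1, hmc2⟩ := hmem m ⟨⟨m, rfl⟩, hm1, hm2⟩
    have hd : M * x < |(m : ℝ) - k| := by
      have e : (n : ℝ) * (γ ^ 2)⁻¹ * δ ^ 2 * ((m : ℝ) / n - k / n) = (m - k) / x := by
        rw [hx]; field_simp
      rw [e, abs_div, abs_of_pos hx0, lt_div_iff₀ hx0] at hfar
      exact hfar
    have hmk : m ≠ k := by
      rintro rfl
      rw [sub_self, abs_zero] at hd
      have : 0 < M * x := by positivity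
      linarith
    have hm0 : 0 < m := by
      have : (0 : ℝ) < m := by linarith
      exact_mod_cast this
    have hmn : m < n := by
      have : (m : ℝ) < n := by linarith
      exact_mod_cast this
    have hk0 : 0 < k := by
      have : (0 : ℝ) < k := by linarith
      exact_mod_cast this
    have hkn' : k < n := by
      have : (k : ℝ) < n := by linarith
      exact_mod_cast this
    have hS := sum_Icc_natCast (fun t => linearProcess T η t ω) 1 k
    have hS' := sum_Icc_natCast (fun t => linearProcess T η t ω) (k + 1) n
    push_cast at hS hS'
    have hlt := splitScore_lt_of_noiseSmall hc hc' hn hk1.le hk2.le hmc1.le hmc2.le hμ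
      (fun t => linearProcess T η t ω) (fun h => ?_) (fun h => ?_) hmk
    · have hle := hmin _ hkc
      rw [lsCriterion_eq hm0 hmn, lsCriterion_eq hk0 hkn'] at hle
      have := le_of_mul_le_mul_left hle (by positivity)
      linarith
    · have hcast : ((k - m : ℕ) : ℝ) = (k : ℝ) - m := Nat.cast_sub h.le
      have hmk' : (m : ℝ) < k := by exact_mod_cast h
      rw [abs_sub_comm, abs_of_pos (by linarith)] at hd
      obtain ⟨i, hi, h1, h2⟩ := hblock ((k : ℝ) - m) (by linarith) hd
      have hb' := not_not.1 fun hcon =>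
        g3 i hi ⟨k - m, by rw [hcast]; exact h1, by rw [hcast]; exact h2, hcon⟩
      rw [hcast] at hb'
      rw [hS, hS', sum_Icc_eq_sum_range_sub (fun t => linearProcess T η t ω) h.le]
      exact ⟨g1, g2, hb'.1, hb'.2.1, hb'.2.2.1, hb'.2.2.2⟩
    · have hcast : ((m - k : ℕ) : ℝ) = (m : ℝ) - k := Nat.cast_sub h.le
      have hmk' : (k : ℝ) < m := by exact_mod_cast h
      rw [abs_of_pos (by linarith)] at hd
      obtain ⟨i, hi, h1, h2⟩ := hblock ((m : ℝ) - k) (by linarith) hd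
      have hb' := not_not.1 fun hcon =>
        g4 i hi ⟨m - k, by rw [hcast]; exact h1, by rw [hcast]; exact h2, hcon⟩
      rw [hcast] at hb'
      rw [hS, hS', sum_Icc_eq_sum_range_add (fun t => linearProcess T η t ω) h.le]
      exact ⟨g1, g2, hb'.1, hb'.2.1, hb'.2.2.1, hb'.2.2.2⟩
  · calc _ ≤ _ := (measure_union_le _ _).trans (add_le_add (measure_union_le _ _)
          (measure_union_le _ _))
      _ ≤ _ := add_le_add (add_le_add q1 q2) (add_le_add q3 q4)
      _ = _ := by
          rw [← ENNReal.ofReal_add (by positivity) (by positivity),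
            ← ENNReal.ofReal_add (by positivity) (by positivity),
            ← ENNReal.ofReal_add (by positivity) (by positivity)]
          congr 1
          field_simp
          ring

end LinearProcess

/-! ### The asymptotic statement -/

theorem theorem1 {Ω : Type*} [MeasurableSpace Ω] (P : Measure Ω) [IsProbabilityMeasure P]
    (η : ℕ → ℤ → Ω → ℝ) (hη : IsInnovationArray P η)
    (p : ℕ → ℕ) (hp : Tendsto p atTop atTop)
    (A : ∀ n : ℕ, ℕ → Matrix (Fin (p n)) (Fin (p n)) ℝ)
    (hA : ∀ n, Summable fun j => specNorm (A n j))
    (μ₁ μ₂ : ∀ n : ℕ, EuclideanSpace ℝ (Fin (p n)))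
    (c : ℝ) (hc : 0 < c) (hc' : c < 1 / 2)
    (τ : ℕ → ℝ) (hτ : ∀ᶠ n in atTop, τ n ∈ candidates n c)
    (hSNR : Tendsto (fun n : ℕ =>
      (n : ℝ) * ((gammaCoef (A n)) ^ 2)⁻¹ / (p n : ℝ) * ‖μ₁ n - μ₂ n‖ ^ 2) atTop atTop)
    (τhat : ℕ → Ω → ℝ)
    (hτhat : ∀ᶠ n in atTop, ∀ᵐ ω ∂P, IsLeastSquaresEstimate n c
      (observation n (τ n) (μ₁ n) (μ₂ n) (A n) η ω) (τhat n ω)) :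
    IsBigOPOne P (fun n ω =>
      (n : ℝ) * ((gammaCoef (A n)) ^ 2)⁻¹ * ‖μ₁ n - μ₂ n‖ ^ 2 * (τhat n ω - τ n)) := by
  intro ε hε
  obtain ⟨e, he0, heε⟩ : ∃ e : ℝ, 0 < e ∧ ENNReal.ofReal e ≤ ε := by
    obtain ⟨q, hq0, hq⟩ := ENNReal.lt_iff_exists_nnreal_btwn.1 hε
    exact ⟨q, by exact_mod_cast hq0, by rw [ENNReal.ofReal_coe_nnreal]; exact hq.le⟩
  set κ := c ^ 2 / 100 with hκdef
  have hκ : 0 < κ := by positivity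
  have hK : 0 ≤ ∫ ω, η 0 0 ω ^ 4 ∂P := integral_nonneg fun ω => by positivity
  set C := 2 + 512 * (88 + 66 * ∫ ω, η 0 0 ω ^ 4 ∂P) with hC
  have hC0 : 0 < C := by positivity
  -- This `M` makes the first term of the finite sample bound at most `e / 2`; the lower bound `2 *
  -- C / (κ ^ 2 * e)` on the signal-to-noise ratio does the same for the second.
  set M := max 1 (1152 / (κ ^ 2 * e)) with hM
  have hM1 : 1 ≤ M := le_max_left _ _
  have hM0 : 0 < M := by linarith
  refine ⟨M, ?_⟩
  filter_upwards [hτ, hτhat, eventually_gt_atTop 0,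
    hSNR.eventually_ge_atTop (max (128 / κ) (2 * C / (κ ^ 2 * e)))] with n hτn hhat hn hsnr
  have hn' : (0 : ℝ) < n := by exact_mod_cast hn
  set γ := gammaCoef (A n) with hγdef
  set δ := ‖μ₁ n - μ₂ n‖ with hδdef
  set R := (n : ℝ) * (γ ^ 2)⁻¹ / (p n : ℝ) * δ ^ 2 with hR
  have hR1 : 128 / κ ≤ R := (le_max_left _ _).trans hsnr
  have hR2 : 2 * C / (κ ^ 2 * e) ≤ R := (le_max_right _ _).trans hsnr
  have hR0 : 0 < R := lt_of_lt_of_le (by positivity) hR1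
  -- Since division by zero gives zero, positivity of the ratio excludes all degenerate cases.
  have hγ0 : γ ≠ 0 := fun h => by simp [hR, h] at hR0
  have hp0 : (p n : ℝ) ≠ 0 := fun h => by simp [hR, h] at hR0
  have hδ0 : δ ≠ 0 := fun h => by simp [hR, h] at hR0
  have hγ : 0 < γ := lt_of_le_of_ne (tsum_nonneg fun _ => norm_nonneg _) hγ0.symm
  have hδ : 0 < δ := lt_of_le_of_ne (norm_nonneg _) hδ0.symm
  have hpn : 0 < (p n : ℝ) := lt_of_le_of_ne (Nat.cast_nonneg _) hp0.symm
  have hμ : μ₁ n ≠ μ₂ n := sub_ne_zero.1 (norm_pos_iff.1 hδ)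
  have hrR : γ ^ 2 * p n / (n * δ ^ 2) = R⁻¹ := by
    rw [hR]; field_simp
  have hr : 128 * (γ ^ 2 * p n) ≤ κ * (n * δ ^ 2) := by
    rw [div_le_iff₀ hκ] at hR1
    have e1 : R * (γ ^ 2 * p n) = n * δ ^ 2 := by rw [hR]; field_simp
    calc 128 * (γ ^ 2 * p n) ≤ R * κ * (γ ^ 2 * p n) := by gcongr
      _ = _ := by rw [← e1]; ring
  have hs : ∀ᵐ ω ∂P, LinearSummable
      (fun j => Matrix.toEuclideanCLM (n := Fin (p n)) (𝕜 := ℝ) (A n j)) η ω :=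
    ae_all_iff.2 fun t => ae_summable_maError hη (hA n) t
  refine (measure_estimate_far_le hη hs (hA n) hc hc' hM1 hμ hγ hn hτn hr hhat).trans
    (le_trans (ENNReal.ofReal_le_ofReal ?_) heε)
  have t1 : 576 / (κ ^ 2 * M) ≤ e / 2 := by
    have : 1152 / (κ ^ 2 * e) ≤ M := le_max_right _ _
    rw [div_le_iff₀ (by positivity)] at this ⊢
    linarith
  have t2 : C * (γ ^ 2 * p n / (n * δ ^ 2)) / κ ^ 2 ≤ e / 2 := by
    rw [hrR, div_le_iff₀ (by positivity), ← div_eq_mul_inv, div_le_iff₀ hR0]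
    rw [div_le_iff₀ (by positivity)] at hR2
    linarith
  linarith!
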